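/- **Setting.** Let $\mathcal X$ be a measurable space, $\mathcal Y=\{-1,1\}$, and let $\mathcal H$ be a class of measurable functions $\mathcal X\to\mathcal Y$ of finite VC dimension $d$. For a probability measure $\mathcal D$ on $\mathcal X\times\mathcal Y$ and measurable $h:\mathcal X\to\mathcal Y$ let $\mathcal L_{\mathcal D}(h)=\Pr_{(x,y)\sim\mathcal D}[h(x)\neq y]$ and $\tau=\inf_{h\in\mathcal H}\mathcal L_{\mathcal D}(h)$. Let $\mathcal A$ be an ERM learner for $\mathcal H$: for every finite training sequence $S$, $\mathcal A(S)\in\mathcal H$ minimizes the number of errors on $S$ over $\mathcal H$. The map $(S,x)\mapsto\mathcal A(S)(x)$ is assumed measurable on $(\mathcal X\times\mathcal Y)^n\times\mathcal X$ for each $n$. **Splitting.** For sequences $S,T$ with $|S|=3^k$ define a finite family (with multiplicity) $\mathcal S(S;T)$ of sequences as follows ($\sqcup$ is concatenation). If $k<6$, its only member is $S\sqcup T$. If $k\ge 6$, cut $S$ into $27$ consecutive blocks $S_1,\dots,S_{27}$ of length $3^{k-3}$, let $S_{i,\sqcup}$ be the first $3^{k-6}$ entries of $S_i$ and $S_{i,\sqcap}$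 the remaining ones, and let $\mathcal S(S;T)$ be the union with multiplicity of the families $\mathcal S(S_{i,\sqcup};S_{i,\sqcap}\sqcup T)$, $i=1,\dots,27$. **Voters.** For $t\in\mathbb N$ let $\widehat{\mathcal A}_{\mathbf t}(S)$ be the multiset of the $t$ classifiers $\mathcal A(S'_1),\dots,\mathcal A(S'_t)$, where $S'_1,\dots,S'_t$ are drawn independently and uniformly with replacement from $\mathcal S(S;\emptyset)$; $\mathbf t$ denotes the randomness of these draws. **Tie-breaking.** Let $m=3^k$ and split $\mathbf S\sim\mathcal D^m$ into three consecutive parts $\mathbf S_1,\mathbf S_2,\mathbf S_3$ of length $m/3$. Draw $\widehat{\mathcal A}_{\mathbf t_1}(\mathbf S_1)$ ($t_1$ voters) and $\widehat{\mathcal A}_{\mathbf t_2}(\mathbf S_2)$ ($t_2$ voters) with independent randomness $\mathbf t_1,\mathbf t_2$. Let $\mathbf S_3^{\neq}$ be the subsequence of those $(x,y)$ in $\mathbf S_3$ on which at least an $11/243$ fraction of the voters in $\widehat{\mathcal A}_{\mathbf t_1}(\mathbf S_1)$, or at least an $11/243$ fraction of those in $\widehat{\mathcal A}_{\mathbf t_2}(\mathbf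 S_2)$, predict a label different from $y$, and let $h_{\mathrm{tie}}=\mathcal A(\mathbf S_3^{\neq})$. Let $\mathrm{Tie}^{11/243}(x)$ be the label $y$ if at least a $232/243$ fraction of the voters in $\widehat{\mathcal A}_{\mathbf t_1}(\mathbf S_1)$ and at least a $232/243$ fraction of those in $\widehat{\mathcal A}_{\mathbf t_2}(\mathbf S_2)$ predict $y$ at $x$; if there is no such label, let it be $h_{\mathrm{tie}}(x)$. **Theorem.** There is a universal constant $c\ge 1$ such that for all $\mathcal X$, $\mathcal H$, $d$, $\mathcal A$, $\mathcal D$ as above, every $0<\delta<1$, every $m=3^k$ with $k\ge5$, and all natural numbers $$t_1,t_2\ \ge\ 4\cdot 243^2\,\ln\!\left(\frac{2m}{\delta\,(d+\ln(86/\delta))}\right),$$ with probability at least $1-\delta$ over $\mathbf S\sim\mathcal D^m$ and the draws $\mathbf t_1,\mathbf t_2$, $$\mathcal L_{\mathcal D}\big(\mathrm{Tie}^{11/243}\big)\ \le\ 2.0888\,\tau+\sqrt{\frac{c\,\tau\,(d+\ln(e/\delta))}{m}}+\frac{c\,(d+\ln(e/\delta))}{m}.$$ -/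

import Mathlib

open MeasureTheory

namespace TieLearn

/-- A labelled example. `Bool` plays the role of the two-element label set `{-1, 1}`. -/
abbrev Example (X : Type*) := X × Bool

/-- A learner maps finite training sequences to classifiers. -/
abbrev Learner (X : Type*) := List (Example X) → X → Bool

/-- `H` shatters the finite set `C`: every labelling of `C` is realised by some `h ∈ H`. -/
def Shatters {X : Type*} (H : Set (X → Bool)) (C : Finset X) : Prop :=
  ∀ f : X → Bool, ∃ h ∈ H, ∀ x ∈ C, h x = f x

/-- `H` has (finite) VC dimension `d`: the largest cardinality of a shattered set is `d`. -/
def HasVCDim {X : Type*} (H : Set (X → Bool)) (d : ℕ) : Prop :=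
  IsGreatest {n : ℕ | ∃ C : Finset X, C.card = n ∧ Shatters H C} d

/-- Empirical 0-1 error of `h` on the sequence `S` (equal to `0` on the empty sequence). -/
noncomputable def empErr {X : Type*} (S : List (Example X)) (h : X → Bool) : ℝ :=
  (S.countP (fun z => h z.1 != z.2) : ℝ) / (S.length : ℝ)

/-- `A` is a (proper) empirical risk minimizer for `H`. -/
def IsERM {X : Type*} (H : Set (X → Bool)) (A : Learner X) : Prop :=
  ∀ S : List (Example X), A S ∈ H ∧ ∀ h ∈ H, empErr S (A S) ≤ empErr S h

/-- The prediction of the learner depends measurably on the training sequence and the point. -/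
def MeasurableLearner {X : Type*} [MeasurableSpace X] (A : Learner X) : Prop :=
  ∀ n : ℕ, Measurable fun p : (Fin n → Example X) × X => A (List.ofFn p.1) p.2

/-- True 0-1 error of `h` under `D`. -/
noncomputable def err {X : Type*} [MeasurableSpace X] (D : Measure (Example X))
    (h : X → Bool) : ℝ :=
  D.real {z | h z.1 ≠ z.2}

/-- The best error attainable in the class `H`. -/
noncomputable def bestErr {X : Type*} [MeasurableSpace X] (D : Measure (Example X))
    (H : Set (X → Bool)) : ℝ :=
  sInf (err D '' H)

/-- The `i`-th (counting from `0`) block of `n` consecutive entries of `S`. -/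
def block {α : Type*} (S : List α) (i n : ℕ) : List α :=
  (S.drop (i * n)).take n

/-- The recursive splitting scheme, for `S` of length `3 ^ k`. If `k = k' + 6`, cut `S` into 27
blocks of length `3 ^ (k - 3) = 3 ^ (k' + 3)`; recurse on the first `3 ^ (k - 6) = 3 ^ k'` entries
of each block, putting the rest of that block in front of `T`. If `k < 6`, return `S ++ T`. -/
def splitting {α : Type*} : ℕ → List α → List α → List (List α)
  | k + 6, S, T => (List.range 27).flatMap fun i =>
      splitting k ((block S i (3 ^ (k + 3))).take (3 ^ k))
        ((block S i (3 ^ (k + 3))).drop (3 ^ k) ++ T)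
  | 0, S, T => [S ++ T]
  | 1, S, T => [S ++ T]
  | 2, S, T => [S ++ T]
  | 3, S, T => [S ++ T]
  | 4, S, T => [S ++ T]
  | 5, S, T => [S ++ T]

/-- The splitting scheme produces `27 ^ ⌊k / 6⌋` training sequences. -/
theorem length_splitting {α : Type*} (k : ℕ) (S T : List α) :
    (splitting k S T).length = 27 ^ (k / 6) := by
  induction k, S, T using splitting.induct with
  | case1 k S T ih =>
    rw [splitting, List.length_flatMap]
    have h : (k + 6) / 6 = k / 6 + 1 := by omega
    rw [List.map_congr_left (fun i _ => ih i), List.map_const', List.sum_replicate,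
      List.length_range, smul_eq_mul, h, pow_succ, mul_comm]
  | _ => simp [splitting]

/-- The `t` voters selected by the draws `i : Fin t → Fin (27 ^ (k / 6))`: the learner run on the
drawn members of the family `splitting k S []`, where `S` has length `3 ^ k`. -/
def voters {X : Type*} (A : Learner X) (k : ℕ) (S : List (Example X)) {t : ℕ}
    (i : Fin t → Fin (27 ^ (k / 6))) : Fin t → X → Bool :=
  fun j => A ((splitting k S []).get (Fin.cast (length_splitting k S []).symm (i j)))

/-- The law of the draws: `t` independent uniform draws, with replacement, from the
`27 ^ (k / 6)` members of the family. -/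
noncomputable def draws (k t : ℕ) : Measure (Fin t → Fin (27 ^ (k / 6))) :=
  Measure.pi fun _ => (PMF.uniformOfFintype (Fin (27 ^ (k / 6)))).toMeasure

/-- The fraction of the voters that predict `y` at `x`. -/
noncomputable def avgEq {X : Type*} {t : ℕ} (v : Fin t → X → Bool) (x : X) (y : Bool) : ℝ :=
  ((Finset.univ.filter fun j => v j x = y).card : ℝ) / (t : ℝ)

/-- The fraction of the voters that err on the example `(x, y)`. -/
noncomputable def avgNe {X : Type*} {t : ℕ} (v : Fin t → X → Bool) (x : X) (y : Bool) : ℝ :=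
  ((Finset.univ.filter fun j => v j x ≠ y).card : ℝ) / (t : ℝ)

open Classical in
/-- The examples of `S₃` on which at least one of the two families of voters has an error
fraction of at least `11 / 243`. -/
noncomputable def tieSample {X : Type*} {t₁ t₂ : ℕ} (v₁ : Fin t₁ → X → Bool)
    (v₂ : Fin t₂ → X → Bool) (S₃ : List (Example X)) : List (Example X) :=
  S₃.filter fun z => decide (11 / 243 ≤ avgNe v₁ z.1 z.2 ∨ 11 / 243 ≤ avgNe v₂ z.1 z.2)

/-- Both families of voters predict `y` at `x` with confidence at least `232 / 243`. -/
def BothAgree {X : Type*} {t₁ t₂ : ℕ} (v₁ : Fin t₁ → X → Bool) (v₂ : Fin t₂ → X → Bool)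
    (x : X) (y : Bool) : Prop :=
  232 / 243 ≤ avgEq v₁ x y ∧ 232 / 243 ≤ avgEq v₂ x y

open Classical in
/-- The label on which both families agree with confidence at least `232 / 243` (at most one label
qualifies), and the label given by `h` if there is none. -/
noncomputable def tie {X : Type*} {t₁ t₂ : ℕ} (v₁ : Fin t₁ → X → Bool)
    (v₂ : Fin t₂ → X → Bool) (h : X → Bool) : X → Bool := fun x =>
  if BothAgree v₁ v₂ x true then true
  else if BothAgree v₁ v₂ x false then false
  else h x

/-- The classifier produced from a training sequence `S` of length `3 ^ k` and draws `i₁`, `i₂`: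
`S` is cut into consecutive thirds, the first two of which are used for the two families of voters
and the last one for the tie-breaker. -/
noncomputable def tieMajority {X : Type*} (A : Learner X) (k : ℕ) (S : List (Example X))
    {t₁ t₂ : ℕ} (i₁ : Fin t₁ → Fin (27 ^ ((k - 1) / 6)))
    (i₂ : Fin t₂ → Fin (27 ^ ((k - 1) / 6))) : X → Bool :=
  let v₁ := voters A (k - 1) (block S 0 (3 ^ (k - 1))) i₁
  let v₂ := voters A (k - 1) (block S 1 (3 ^ (k - 1))) i₂
  tie v₁ v₂ (A (tieSample v₁ v₂ (block S 2 (3 ^ (k - 1)))))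

end TieLearn

/-!
Symmetrization by a ghost sample, combined with Pajor's refinement of the Sauer–Shelah lemma, shows
that an empirical risk minimizer trained on a sample containing `n` points that are independent of
a region `R` errs inside `R` with probability at most `1.0001 N / n`, up to a tiny multiple of the
mass of `R` and a term of order `(d + ln (1 / δ)) / n`, where `N` counts the errors of a fixed
competitor on the whole sample. The cost of the union bound is proportional to the mass of `R`, so
no logarithmic factor in the sample size appears.

Each of the 27 branches of the splitting family trains on `S_{i,⊓}`, which the other branches never
see. Hence two different branches rarely err on a common example, and by induction on the level at
least 10/243 of the members err only on a set of mass `O(τ + (d + ln (1 / δ)) / m)`. On this set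
the tie-breaker contributes `τ` up to small terms. Outside of it, a wrong vote means that 232/243 of
the second family and 232/243 of the first family err. Each member of the first family trains inside
one block, on at least 26/27 of its points, all independent of the second family, so this event
contributes `(243/232) (27/26) τ < 1.0878 τ`. The sum is below `2.0888 τ`, and the difference
absorbs all small constants, so that the square root in the bound is not even needed.
-/

namespace TieLearn

open Set ProbabilityTheory
open scoped ENNReal NNReal Finset

section Symmetrization

variable {Z J : Type*}

/-- The two halves of a double sample, indexed by `J × Bool` and listed as one family of points. -/
def doublePoints (w : J → Z × Z) : J × Bool → Z := fun a => bif a.2 then (w a.1).2 else (w a.1).1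

/-- The double sample with the two points of each pair `j` with `σ j = true` exchanged. -/
def swapPairs (σ : J → Bool) (w : J → Z × Z) : J → Z × Z :=
  fun j => bif σ j then (w j).swap else w j

theorem doublePoints_swapPairs (σ : J → Bool) (w : J → Z × Z) (j : J) (b : Bool) :
    doublePoints (swapPairs σ w) (j, b) = doublePoints w (j, xor (σ j) b) := by
  cases hσ : σ j <;> cases b <;> simp [doublePoints, swapPairs, hσ]

variable [Fintype J]

open Classical in
/-- The index sets cut out by the members of the family `𝓔` on the finite family of points `p`. -/
noncomputable def traces {α : Type*} [Fintype α] (𝓔 : Set (Set Z)) (p : α → Z) :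
    Finset (Finset α) :=
  {P | ∃ E ∈ 𝓔, ∀ a, a ∈ P ↔ p a ∈ E}

theorem mem_traces {α : Type*} [Fintype α] {𝓔 : Set (Set Z)} {p : α → Z} {P : Finset α} :
    P ∈ traces 𝓔 p ↔ ∃ E ∈ 𝓔, ∀ a, a ∈ P ↔ p a ∈ E := by
  simp [traces]

theorem mul_add_mul_le_two {α β : ℝ≥0∞} (h : α + β ≤ 2) : α * β + α * β ≤ 2 := by
  lift α to ℝ≥0 using ne_top_of_le_ne_top (by simp) (le_self_add.trans h)
  lift β to ℝ≥0 using ne_top_of_le_ne_top (by simp) (le_add_self.trans h)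
  norm_cast at h ⊢
  rw [← NNReal.coe_le_coe] at h ⊢
  push_cast at h ⊢
  nlinarith [sq_nonneg ((α : ℝ) - β), α.coe_nonneg, β.coe_nonneg]

open Classical in
theorem sum_prod_swap_le {α β : ℝ≥0∞} (h : α + β ≤ 2) (P : Finset (J × Bool)) :
    ∑ σ : J → Bool, ∏ j, (if (j, !σ j) ∈ P then α else 1) * (if (j, σ j) ∈ P then β else 1)
      ≤ 2 ^ Fintype.card J := by
  have hfactor := Finset.prod_univ_sum (fun _ : J => (Finset.univ : Finset Bool))
    (fun j b => (if (j, !b) ∈ P then α else 1) * (if (j, b) ∈ P then β else 1))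
  rw [Fintype.piFinset_univ] at hfactor
  rw [← hfactor]
  calc _ ≤ ∏ _j : J, (2 : ℝ≥0∞) := by
        refine Finset.prod_le_prod' fun j _ => ?_
        rw [Fintype.sum_bool]
        have hmul := mul_add_mul_le_two h
        by_cases htrue : (j, true) ∈ P <;> by_cases hfalse : (j, false) ∈ P <;>
          simp [htrue, hfalse, h, hmul, one_add_one_eq_two, add_comm β]
    _ = _ := by simp

open Classical in
theorem prod_mulIndicator_const (E : Set Z) (a : ℝ≥0∞) (u : J → Z) :
    ∏ j, E.mulIndicator (fun _ => a) (u j) = a ^ #{j | u j ∈ E} := by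
  simp [mulIndicator_apply, Finset.prod_ite]

/-- The factor by which the ghost half `v` of the double sample `(u, v)` rewards, and the actual
half `u` penalizes, each point that falls into `E`. -/
noncomputable def swapWeight (α β : ℝ≥0∞) (E : Set Z) (w : J → Z × Z) : ℝ≥0∞ :=
  ∏ j, E.mulIndicator (fun _ => α) (w j).2 * E.mulIndicator (fun _ => β) (w j).1

open Classical in
theorem sum_swapWeight_le {𝓔 : Set (Set Z)} {E : (J → Bool) → Set Z} (hE : ∀ σ, E σ ∈ 𝓔)
    {α β : ℝ≥0∞} (h : α + β ≤ 2) (w : J → Z × Z) :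
    ∑ σ, swapWeight α β (E σ) (swapPairs σ w)
      ≤ 2 ^ Fintype.card J * #(traces 𝓔 (doublePoints w)) := by
  let weight (P : Finset (J × Bool)) (σ : J → Bool) : ℝ≥0∞ :=
    ∏ j, (if (j, !σ j) ∈ P then α else 1) * (if (j, σ j) ∈ P then β else 1)
  have hweight σ : swapWeight α β (E σ) (swapPairs σ w)
      = weight ({a | doublePoints w a ∈ E σ} : Finset (J × Bool)) σ := by
    refine Finset.prod_congr rfl fun j _ => ?_
    have hsnd : (swapPairs σ w j).2 = doublePoints w (j, !σ j) :=
      (doublePoints_swapPairs σ w j true).trans (by rw [Bool.xor_true])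
    have hfst : (swapPairs σ w j).1 = doublePoints w (j, σ j) :=
      (doublePoints_swapPairs σ w j false).trans (by rw [Bool.xor_false])
    simp only [hsnd, hfst, mulIndicator_apply, Finset.mem_filter_univ]
  calc ∑ σ, swapWeight α β (E σ) (swapPairs σ w)
      ≤ ∑ σ, ∑ P ∈ traces 𝓔 (doublePoints w), weight P σ := by
        refine Finset.sum_le_sum fun σ _ => ?_
        rw [hweight]
        exact Finset.single_le_sum (f := (weight · σ)) (fun _ _ => zero_le)
          (mem_traces.2 ⟨E σ, hE σ, by simp⟩)
    _ = ∑ P ∈ traces 𝓔 (doublePoints w), ∑ σ, weight P σ := Finset.sum_comm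
    _ ≤ ∑ _P ∈ traces 𝓔 (doublePoints w), 2 ^ Fintype.card J :=
        Finset.sum_le_sum fun P _ => sum_prod_swap_le h P
    _ = _ := by rw [Finset.sum_const, nsmul_eq_mul, mul_comm]

variable [MeasurableSpace Z] (D : Measure Z) [IsProbabilityMeasure D]

theorem measurePreserving_swapPairs (σ : J → Bool) :
    MeasurePreserving (swapPairs σ) (Measure.pi fun _ : J => D.prod D)
      (Measure.pi fun _ : J => D.prod D) := by
  refine measurePreserving_pi _ _ (f := fun j (p : Z × Z) => bif σ j then p.swap else p) fun j => ?_
  cases σ j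
  · exact MeasurePreserving.id _
  · exact Measure.measurePreserving_swap

theorem lintegral_swapWeight_le {𝓔 : Set (Set Z)} {E : (J → Z) → Set Z}
    (hEm : MeasurableSet {q : (J → Z) × Z | q.2 ∈ E q.1}) (hE : ∀ u, E u ∈ 𝓔)
    {α β : ℝ≥0∞} (h : α + β ≤ 2) :
    ∫⁻ w, swapWeight α β (E fun j => (w j).1) w ∂(Measure.pi fun _ : J => D.prod D)
      ≤ ∫⁻ w, #(traces 𝓔 (doublePoints w)) ∂(Measure.pi fun _ : J => D.prod D) := by
  classical
  have hmeas : Measurable fun w : J → Z × Z => swapWeight α β (E fun j => (w j).1) w := by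
    unfold swapWeight
    simp only [mulIndicator_apply]
    refine Finset.measurable_prod _ fun j _ => (Measurable.ite ?_ measurable_const
      measurable_const).mul (Measurable.ite ?_ measurable_const measurable_const)
    · exact (by fun_prop : Measurable fun w : J → Z × Z => (fun j => (w j).1, (w j).2)) hEm
    · exact (by fun_prop : Measurable fun w : J → Z × Z => (fun j => (w j).1, (w j).1)) hEm
  have htop : (2 : ℝ≥0∞) ^ Fintype.card J ≠ ∞ := by finiteness
  rw [← ENNReal.mul_le_mul_iff_right (by positivity) htop, ← lintegral_const_mul' _ _ htop,
    ← lintegral_const_mul' _ _ htop]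
  calc _ = ∑ σ, ∫⁻ w, swapWeight α β (E fun j => (swapPairs σ w j).1) (swapPairs σ w)
        ∂(Measure.pi fun _ : J => D.prod D) := by
        simp [(measurePreserving_swapPairs D _).lintegral_comp hmeas, lintegral_const_mul' _ _ htop]
    _ = ∫⁻ w, ∑ σ, swapWeight α β (E fun j => (swapPairs σ w j).1) (swapPairs σ w)
        ∂(Measure.pi fun _ : J => D.prod D) :=
        (lintegral_finsetSum _ fun σ _ =>
          hmeas.comp (measurePreserving_swapPairs D σ).measurable).symm
    _ ≤ _ := lintegral_mono fun w =>
        sum_swapWeight_le (fun σ => hE fun j => (swapPairs σ w j).1) h w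

end Symmetrization

section GhostSample

variable {Z J : Type*} [MeasurableSpace Z] [Fintype J] (D : Measure Z) [IsProbabilityMeasure D]

theorem lintegral_pi_prod {f : Z → ℝ≥0∞} (hf : Measurable f) :
    ∫⁻ u, ∏ j, f (u j) ∂(Measure.pi fun _ : J => D) = (∫⁻ z, f z ∂D) ^ Fintype.card J := by
  rw [lintegral_prod_eq_prod_lintegral_of_indepFun Finset.univ _
    (iIndepFun_pi (μ := fun _ : J => D) (X := fun _ => f) fun _ => hf.aemeasurable)
    fun j => hf.comp (measurable_pi_apply j)]
  simp [(measurePreserving_eval (fun _ : J => D) _).lintegral_comp hf]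

theorem measurable_mulIndicator_const {E : Set Z} (hE : MeasurableSet E) (a : ℝ≥0∞) :
    Measurable (E.mulIndicator fun _ => a) := by
  classical
  exact Measurable.ite hE measurable_const measurable_const

theorem lintegral_mulIndicator_const {E : Set Z} (hE : MeasurableSet E) {a : ℝ} (ha : 0 ≤ a) :
    ∫⁻ z, E.mulIndicator (fun _ => ENNReal.ofReal a) z ∂D
      = ENNReal.ofReal (1 + D.real E * (a - 1)) := by
  have hsplit : E.mulIndicator (fun _ => ENNReal.ofReal a)
      = fun z => E.indicator (fun _ => ENNReal.ofReal a) z + Eᶜ.indicator (fun _ => 1) z := by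
    ext z
    by_cases hz : z ∈ E <;> simp [hz]
  rw [hsplit, lintegral_add_left (measurable_const.indicator hE), lintegral_indicator_const hE,
    lintegral_indicator_const hE.compl, ← ofReal_measureReal, ← ofReal_measureReal,
    probReal_compl_eq_one_sub hE, ← ENNReal.ofReal_mul ha, one_mul,
    ← ENNReal.ofReal_add (mul_nonneg ha measureReal_nonneg) (sub_nonneg.2 measureReal_le_one)]
  ring_nf

theorem lintegral_pi_prod_mulIndicator {E : Set Z} (hE : MeasurableSet E) {a : ℝ} (ha : 0 ≤ a) :
    ∫⁻ u, ∏ j, E.mulIndicator (fun _ => ENNReal.ofReal a) (u j) ∂(Measure.pi fun _ : J => D)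
      = ENNReal.ofReal (1 + D.real E * (a - 1)) ^ Fintype.card J := by
  rw [lintegral_pi_prod D (measurable_mulIndicator_const hE _),
    lintegral_mulIndicator_const D hE ha]

theorem exp_mul_le_one_add {p : ℝ} (hp : 0 ≤ p) (hp1 : p ≤ 1) (l : ℝ) :
    Real.exp (p * l) ≤ 1 + p * (Real.exp l - 1) := by
  have := convexOn_exp.2 (mem_univ 0) (mem_univ l) (sub_nonneg.2 hp1) hp (by ring)
  simp only [smul_eq_mul, mul_zero, zero_add, Real.exp_zero, mul_one] at this
  linarith

open Classical in
theorem ofReal_exp_deviation_le_lintegral {E : Set Z} (hE : MeasurableSet E) (l κ : ℝ)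
    (u : J → Z) :
    ENNReal.ofReal (Real.exp (l * (Fintype.card J * D.real E - κ * #{j | u j ∈ E})))
      ≤ ∫⁻ v, swapWeight (ENNReal.ofReal (Real.exp l)) (ENNReal.ofReal (Real.exp (-(κ * l)))) E
          (fun j => (u j, v j)) ∂(Measure.pi fun _ : J => D) := by
  have hexp := exp_mul_le_one_add measureReal_nonneg (measureReal_le_one (μ := D) (s := E)) l
  simp only [swapWeight, Finset.prod_mul_distrib, prod_mulIndicator_const E _ u]
  rw [lintegral_mul_const' _ _ (by finiteness),
    lintegral_pi_prod_mulIndicator D hE (Real.exp_pos l).le,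
    ← ENNReal.ofReal_pow (Real.exp_pos _).le,
    ← ENNReal.ofReal_pow ((Real.exp_pos _).le.trans hexp), ← ENNReal.ofReal_mul
    (pow_nonneg ((Real.exp_pos _).le.trans hexp) _)]
  apply ENNReal.ofReal_le_ofReal
  calc _ = Real.exp (D.real E * l) ^ Fintype.card J
        * Real.exp (-(κ * l)) ^ #{j | u j ∈ E} := by
        rw [← Real.exp_nat_mul, ← Real.exp_nat_mul, ← Real.exp_add]
        ring_nf
    _ ≤ _ := by gcongr

open Classical in
theorem lintegral_exp_deviation_le_lintegral_swapWeight {E : (J → Z) → Set Z}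
    (hE : MeasurableSet {q : (J → Z) × Z | q.2 ∈ E q.1}) (l κ : ℝ) :
    ∫⁻ u, ENNReal.ofReal (Real.exp (l * (Fintype.card J * D.real (E u) - κ * #{j | u j ∈ E u})))
        ∂(Measure.pi fun _ : J => D)
      ≤ ∫⁻ w, swapWeight (ENNReal.ofReal (Real.exp l)) (ENNReal.ofReal (Real.exp (-(κ * l))))
          (E fun j => (w j).1) w ∂(Measure.pi fun _ : J => D.prod D) := by
  set α := ENNReal.ofReal (Real.exp l)
  set β := ENNReal.ofReal (Real.exp (-(κ * l)))
  let Φ (q : (J → Z) × (J → Z)) : ℝ≥0∞ := swapWeight α β (E q.1) fun j => (q.1 j, q.2 j)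
  have hΦ : Measurable Φ := by
    simp only [Φ, swapWeight, mulIndicator_apply]
    refine Finset.measurable_prod _ fun j _ => (Measurable.ite ?_ measurable_const
      measurable_const).mul (Measurable.ite ?_ measurable_const measurable_const)
    · exact (by fun_prop : Measurable fun q : (J → Z) × (J → Z) => (q.1, q.2 j)) hE
    · exact (by fun_prop : Measurable fun q : (J → Z) × (J → Z) => (q.1, q.1 j)) hE
  have hpair := (measurePreserving_arrowProdEquivProdArrow Z Z J
    (fun _ => D) (fun _ => D)).lintegral_comp hΦ
  calc _ ≤ ∫⁻ u, ∫⁻ v, Φ (u, v) ∂(Measure.pi fun _ : J => D) ∂(Measure.pi fun _ : J => D) :=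
        lintegral_mono fun u => ofReal_exp_deviation_le_lintegral D (hE.preimage
          measurable_prodMk_left) l κ u
    _ = _ := by
        rw [← lintegral_prod _ hΦ.aemeasurable, ← hpair]
        rfl

end GhostSample

section ErrorTraces

variable {X : Type*} {H : Set (X → Bool)} {d : ℕ}

/-- The set of examples on which the classifier `h` errs. -/
def errSet (h : X → Bool) : Set (Example X) := {z | h z.1 ≠ z.2}

/-- The error sets of the classifiers in `H`, restricted to the region `R`. -/
def errSetsWithin (H : Set (X → Bool)) (R : Set (Example X)) : Set (Set (Example X)) :=
  (fun h => R ∩ errSet h) '' H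

/-- The VC dimension of `H` is at most `d`. -/
def VCDimLE (H : Set (X → Bool)) (d : ℕ) : Prop := ∀ C : Finset X, Shatters H C → #C ≤ d

theorem HasVCDim.vcDimLE (h : HasVCDim H d) : VCDimLE H d := fun C hC => h.2 ⟨C, rfl, hC⟩

variable {α : Type*} [Fintype α] {R : Set (Example X)} {p : α → Example X} {B : Finset α}

theorem mem_of_shatters_traces [DecidableEq α] (hB : (traces (errSetsWithin H R) p).Shatters B)
    {a : α} (ha : a ∈ B) : p a ∈ R := by
  obtain ⟨t, ht, hBt⟩ := hB.exists_superset
  obtain ⟨_, ⟨h, -, rfl⟩, htp⟩ := mem_traces.1 ht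
  exact ((htp a).1 (hBt ha)).1

theorem exists_eq_of_shatters_traces [DecidableEq α]
    (hB : (traces (errSetsWithin H R) p).Shatters B) (f : α → Bool) :
    ∃ h ∈ H, ∀ a ∈ B, h (p a).1 = f a := by
  obtain ⟨_, ht, hBt⟩ := hB (t := {a ∈ B | f a ≠ (p a).2}) (Finset.filter_subset _ _)
  obtain ⟨_, ⟨h, hh, rfl⟩, htp⟩ := mem_traces.1 ht
  refine ⟨h, hh, fun a ha => ?_⟩
  have herr : h (p a).1 ≠ (p a).2 ↔ f a ≠ (p a).2 := by
    simpa [ha, htp, mem_of_shatters_traces hB ha, errSet] using Finset.ext_iff.1 hBt a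
  revert herr
  cases h (p a).1 <;> cases f a <;> cases (p a).2 <;> simp

theorem card_le_of_shatters_traces [DecidableEq α] (hd : VCDimLE H d)
    (hB : (traces (errSetsWithin H R) p).Shatters B) : #B ≤ d := by
  classical
  have hinj : InjOn (fun a => (p a).1) B := by
    intro a ha b hb hab
    obtain ⟨h, -, hh⟩ := exists_eq_of_shatters_traces hB fun c => decide (c = a)
    have := (hh a ha).symm.trans ((congrArg h hab).trans (hh b hb))
    simpa [eq_comm] using this
  rw [← Finset.card_image_of_injOn hinj]
  refine hd _ fun f => ?_
  obtain ⟨h, hh, hf⟩ := exists_eq_of_shatters_traces hB fun a => f (p a).1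
  exact ⟨h, hh, Finset.forall_mem_image.2 hf⟩

open Classical in
/- Pajor's lemma counts the traces by the index sets they shatter, each of which lies in
`{a | p a ∈ R}` and has at most `d` elements. -/
theorem card_traces_mul_pow_le (hd : VCDimLE H d) (R : Set (Example X)) (p : α → Example X)
    {η : ℝ} (hη : 0 ≤ η) (hη1 : η ≤ 1) :
    #(traces (errSetsWithin H R) p) * η ^ d ≤ (1 + η) ^ #{a | p a ∈ R} := by
  set 𝒜 := traces (errSetsWithin H R) p
  have hsub : 𝒜.shatterer ⊆ ({a | p a ∈ R} : Finset α).powerset := fun B hB =>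
    Finset.mem_powerset.2 fun a ha => (Finset.mem_filter_univ a).2
      (mem_of_shatters_traces (Finset.mem_shatterer.1 hB) ha)
  calc (#𝒜 : ℝ) * η ^ d ≤ #𝒜.shatterer * η ^ d := by
        gcongr ?_ * _
        exact_mod_cast 𝒜.card_le_card_shatterer
    _ = ∑ _B ∈ 𝒜.shatterer, η ^ d := by simp
    _ ≤ ∑ B ∈ 𝒜.shatterer, η ^ #B := Finset.sum_le_sum fun B hB =>
        pow_le_pow_of_le_one hη hη1 (card_le_of_shatters_traces hd (Finset.mem_shatterer.1 hB))
    _ ≤ ∑ B ∈ ({a | p a ∈ R} : Finset α).powerset, η ^ #B :=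
        Finset.sum_le_sum_of_subset_of_nonneg hsub fun _ _ _ => by positivity
    _ = (1 + η) ^ #{a | p a ∈ R} := by
        rw [← Finset.prod_const, Finset.prod_one_add]
        simp

variable [MeasurableSpace X] {J : Type*} [Fintype J] (D : Measure (Example X))
  [IsProbabilityMeasure D]

theorem lintegral_card_traces_le (hd : VCDimLE H d) (hR : MeasurableSet R) {η : ℝ} (hη : 0 < η)
    (hη1 : η ≤ 1) :
    ∫⁻ w, #(traces (errSetsWithin H R) (doublePoints w)) ∂(Measure.pi fun _ : J => D.prod D)
      ≤ ENNReal.ofReal ((η ^ d)⁻¹ * Real.exp (2 * η * Fintype.card J * D.real R)) := by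
  classical
  let b : Example X → ℝ≥0∞ := R.mulIndicator fun _ => ENNReal.ofReal (1 + η)
  have hb : Measurable b := measurable_mulIndicator_const hR _
  have hcard w : (#(traces (errSetsWithin H R) (doublePoints w)) : ℝ≥0∞)
      ≤ ENNReal.ofReal (η ^ d)⁻¹ * ∏ j : J, b (w j).1 * b (w j).2 := by
    have hprod : ∏ j : J, b (w j).1 * b (w j).2
        = ENNReal.ofReal ((1 + η) ^ #{a | doublePoints w a ∈ R}) := by
      rw [ENNReal.ofReal_pow (by positivity), ← prod_mulIndicator_const, Fintype.prod_prod_type]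
      simp [doublePoints, b, mul_comm]
    rw [hprod, ← ENNReal.ofReal_mul (by positivity), ← ENNReal.ofReal_natCast]
    refine ENNReal.ofReal_le_ofReal ?_
    rw [inv_mul_eq_div, le_div_iff₀ (by positivity)]
    exact card_traces_mul_pow_le hd R _ hη.le hη1
  have hexp : 1 + D.real R * (1 + η - 1) ≤ Real.exp (η * D.real R) := by
    linarith [Real.add_one_le_exp (η * D.real R)]
  calc _ ≤ ENNReal.ofReal (η ^ d)⁻¹ * ∫⁻ w, ∏ j : J, b (w j).1 * b (w j).2
        ∂(Measure.pi fun _ : J => D.prod D) := by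
        rw [← lintegral_const_mul' _ _ ENNReal.ofReal_ne_top]
        exact lintegral_mono hcard
    _ = ENNReal.ofReal (η ^ d)⁻¹
        * (ENNReal.ofReal (1 + D.real R * (1 + η - 1)) ^ 2) ^ Fintype.card J := by
        rw [lintegral_pi_prod (D.prod D) (f := fun z => b z.1 * b z.2)
          ((hb.comp measurable_fst).mul (hb.comp measurable_snd)),
          lintegral_prod_mul hb.aemeasurable hb.aemeasurable,
          lintegral_mulIndicator_const D hR (by positivity), sq]
    _ ≤ ENNReal.ofReal (η ^ d)⁻¹
        * (ENNReal.ofReal (Real.exp (η * D.real R)) ^ 2) ^ Fintype.card J := by gcongr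
    _ = _ := by
        rw [← pow_mul, ← ENNReal.ofReal_pow (by positivity), ← ENNReal.ofReal_mul (by positivity),
          ← Real.exp_nat_mul]
        push_cast
        ring_nf

open Classical in
theorem lintegral_exp_deviation_le (hd : VCDimLE H d) (hR : MeasurableSet R)
    {E : (J → Example X) → Set (Example X)}
    (hEm : MeasurableSet {q : (J → Example X) × Example X | q.2 ∈ E q.1})
    (hE : ∀ u, E u ∈ errSetsWithin H R) {l κ η : ℝ}
    (hlκ : Real.exp l + Real.exp (-(κ * l)) ≤ 2) (hη : 0 < η) (hη1 : η ≤ 1) :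
    ∫⁻ u, ENNReal.ofReal (Real.exp (l * (Fintype.card J * D.real (E u) - κ * #{j | u j ∈ E u})))
        ∂(Measure.pi fun _ : J => D)
      ≤ ENNReal.ofReal ((η ^ d)⁻¹ * Real.exp (2 * η * Fintype.card J * D.real R)) := by
  have hsum : ENNReal.ofReal (Real.exp l) + ENNReal.ofReal (Real.exp (-(κ * l))) ≤ 2 := by
    rw [← ENNReal.ofReal_add (by positivity) (by positivity)]
    simpa using ENNReal.ofReal_le_ofReal hlκ
  exact (lintegral_exp_deviation_le_lintegral_swapWeight D hEm l κ).trans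
    ((lintegral_swapWeight_le D hEm hE hsum).trans (lintegral_card_traces_le D hd hR hη hη1))

end ErrorTraces

section HoldsExcept

variable {Ω Ω' ρ : Type*} [MeasurableSpace Ω] [MeasurableSpace Ω'] {μ : Measure Ω} {δ δ' : ℝ}
  {p q : Ω → Prop}

/-- The property `p` holds outside an event of probability at most `δ`. -/
def HoldsExcept (μ : Measure Ω) (δ : ℝ) (p : Ω → Prop) : Prop := μ.real {ω | ¬ p ω} ≤ δ

namespace HoldsExcept

theorem mono [IsFiniteMeasure μ] (h : HoldsExcept μ δ p) (hpq : ∀ ω, p ω → q ω) :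
    HoldsExcept μ δ q :=
  (measureReal_mono fun ω (hω : ¬ q ω) hp => hω (hpq ω hp)).trans h

theorem mono_prob (h : HoldsExcept μ δ p) (hδ : δ ≤ δ') : HoldsExcept μ δ' p := h.trans hδ

theorem of_forall (hδ : 0 ≤ δ) (h : ∀ ω, p ω) : HoldsExcept μ δ p := by
  simpa [HoldsExcept, h] using hδ

theorem and (hp : HoldsExcept μ δ p) (hq : HoldsExcept μ δ' q) :
    HoldsExcept μ (δ + δ') fun ω => p ω ∧ q ω := by
  have hsub : {ω | ¬ (p ω ∧ q ω)} = {ω | ¬ p ω} ∪ {ω | ¬ q ω} := by ext; simp [imp_iff_not_or]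
  rw [HoldsExcept, hsub]
  exact (measureReal_union_le _ _).trans (add_le_add hp hq)

theorem forall_of_fintype [Fintype ρ] {p : ρ → Ω → Prop} (h : ∀ r, HoldsExcept μ δ (p r)) :
    HoldsExcept μ (Fintype.card ρ * δ) fun ω => ∀ r, p r ω := by
  have hsub : {ω | ¬ ∀ r, p r ω} = ⋃ r, {ω | ¬ p r ω} := by ext; simp
  rw [HoldsExcept, hsub]
  refine (measureReal_iUnion_fintype_le _).trans ((Finset.sum_le_sum fun r _ => h r).trans ?_)
  simp

theorem forall_of_ne [Fintype ρ] {p : ρ → ρ → Ω → Prop}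
    (h : ∀ r s, r ≠ s → HoldsExcept μ δ (p r s)) (hδ : 0 ≤ δ) :
    HoldsExcept μ (Fintype.card ρ ^ 2 * δ) fun ω => ∀ r s, r ≠ s → p r s ω := by
  have h' (a : ρ × ρ) : HoldsExcept μ δ fun ω => a.1 ≠ a.2 → p a.1 a.2 ω := by
    by_cases ha : a.1 = a.2
    · exact .of_forall hδ fun ω hne => absurd ha hne
    · simpa [ha] using h a.1 a.2 ha
  simpa [HoldsExcept, sq] using forall_of_fintype h'

theorem comp {ν : Measure Ω'} {p : Ω' → Prop} {f : Ω → Ω'} [IsFiniteMeasure ν]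
    (hf : MeasurePreserving f μ ν) (h : HoldsExcept ν δ p) :
    HoldsExcept μ δ fun ω => p (f ω) :=
  (ENNReal.toReal_mono (measure_ne_top _ _) (hf.measure_preimage_le {ω | ¬ p ω})).trans h

theorem one_sub_le [IsProbabilityMeasure μ] (h : HoldsExcept μ δ p) : 1 - δ ≤ μ.real {ω | p ω} := by
  have hunion : {ω | p ω} ∪ {ω | ¬ p ω} = univ := by ext; simp [em]
  have := measureReal_union_le (μ := μ) {ω | p ω} {ω | ¬ p ω}
  rw [hunion, probReal_univ] at this
  linarith [show μ.real {ω | ¬ p ω} ≤ δ from h]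

theorem of_lintegral_le {Y : Ω → ℝ≥0∞} (hY : AEMeasurable Y μ) {B : ℝ} (hB : 0 < B)
    (hI : ∫⁻ ω, Y ω ∂μ ≤ ENNReal.ofReal (δ * B)) (hδ : 0 ≤ δ) :
    HoldsExcept μ δ fun ω => Y ω < ENNReal.ofReal B := by
  refine ENNReal.toReal_le_of_le_ofReal hδ ?_
  simp only [not_lt]
  refine (meas_ge_le_lintegral_div hY (by simpa using hB) ENNReal.ofReal_ne_top).trans ?_
  rw [ENNReal.ofReal_mul hδ] at hI
  exact ENNReal.div_le_of_le_mul hI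

theorem of_lintegral_exp_le {Y : Ω → ℝ} (hY : Measurable Y) {M : ℝ} (hM : 0 < M)
    (hI : ∫⁻ ω, ENNReal.ofReal (Real.exp (Y ω)) ∂μ ≤ ENNReal.ofReal M) (hδ : 0 < δ) :
    HoldsExcept μ δ fun ω => Y ω < Real.log (M / δ) := by
  have hMδ : 0 < M / δ := by positivity
  have h := of_lintegral_le hY.exp.ennreal_ofReal.aemeasurable hMδ
    (by rwa [mul_div_cancel₀ _ hδ.ne']) hδ.le
  simpa [ENNReal.ofReal_lt_ofReal_iff hMδ, Real.lt_log_iff_exp_lt hMδ] using h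

theorem prod {Ω₁ Ω₂ : Type*} [MeasurableSpace Ω₁] [MeasurableSpace Ω₂] {μ : Measure Ω₁}
    {ν : Measure Ω₂} [IsFiniteMeasure μ] [IsProbabilityMeasure ν] [Finite Ω₂]
    [MeasurableSingletonClass Ω₂] {p : Ω₁ → Ω₂ → Prop}
    (h : ∀ i, HoldsExcept μ δ fun ω => p ω i) :
    HoldsExcept (μ.prod ν) δ fun ω => p ω.1 ω.2 := by
  cases nonempty_fintype Ω₂
  have hsub : {ω : Ω₁ × Ω₂ | ¬ p ω.1 ω.2} = ⋃ i, {ω | ¬ p ω i} ×ˢ {i} := by ext; simp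
  rw [HoldsExcept, hsub]
  calc
    _ ≤ ∑ i, (μ.prod ν).real ({ω | ¬ p ω i} ×ˢ {i}) := measureReal_iUnion_fintype_le _
    _ ≤ ∑ i, δ * ν.real {i} := by
      gcongr with i
      rw [measureReal_prod_prod]
      gcongr
      exact h i
    _ = δ := by rw [← Finset.mul_sum, sum_measureReal_singleton]; simp

theorem prod_left {Ω₁ Ω₂ : Type*} [MeasurableSpace Ω₁] [MeasurableSpace Ω₂] {μ : Measure Ω₁}
    {ν : Measure Ω₂} [IsProbabilityMeasure μ] [IsFiniteMeasure ν] {p : Ω₁ → Ω₂ → Prop}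
    (hp : MeasurableSet {ω : Ω₁ × Ω₂ | p ω.1 ω.2}) (h : ∀ i, HoldsExcept ν δ (p i)) :
    HoldsExcept (μ.prod ν) δ fun ω => p ω.1 ω.2 := by
  obtain ⟨i⟩ := μ.nonempty_of_neZero
  have hδ : 0 ≤ δ := measureReal_nonneg.trans (h i)
  refine ENNReal.toReal_le_of_le_ofReal hδ ?_
  calc
    _ = ∫⁻ i, ν {ω | ¬ p i ω} ∂μ := Measure.prod_apply hp.compl
    _ ≤ ∫⁻ _, ENNReal.ofReal δ ∂μ := lintegral_mono fun i =>
      (ENNReal.le_ofReal_iff_toReal_le (measure_ne_top _ _) hδ).2 (h i)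
    _ = _ := by simp

end HoldsExcept

theorem lintegral_exp_average_le [Fintype ρ] [Nonempty ρ] {Y : ρ → Ω → ℝ}
    (hY : ∀ r, Measurable (Y r)) {c : ℝ≥0∞}
    (hI : ∀ r, ∫⁻ ω, ENNReal.ofReal (Real.exp (Y r ω)) ∂μ ≤ c) :
    ∫⁻ ω, ENNReal.ofReal (Real.exp ((∑ r, Y r ω) / Fintype.card ρ)) ∂μ ≤ c := by
  set w : ℝ := (Fintype.card ρ : ℝ)⁻¹
  have hw : 0 ≤ w := by positivity
  have hw1 : ∑ _r : ρ, w = 1 := by simp [w]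
  have jensen ω : Real.exp ((∑ r, Y r ω) / Fintype.card ρ) ≤ ∑ r, w * Real.exp (Y r ω) := by
    have := convexOn_exp.map_sum_le (t := Finset.univ) (w := fun _ : ρ => w)
      (p := fun r => Y r ω) (fun _ _ => hw) hw1 (fun _ _ => mem_univ _)
    rwa [← Finset.smul_sum, smul_eq_mul, ← div_eq_inv_mul] at this
  calc
    _ ≤ ∫⁻ ω, ∑ r, ENNReal.ofReal w * ENNReal.ofReal (Real.exp (Y r ω)) ∂μ := by
      refine lintegral_mono fun ω => (ENNReal.ofReal_le_ofReal (jensen ω)).trans_eq ?_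
      rw [ENNReal.ofReal_sum_of_nonneg fun r _ => by positivity]
      simp only [ENNReal.ofReal_mul hw]
    _ = ∑ r, ENNReal.ofReal w * ∫⁻ ω, ENNReal.ofReal (Real.exp (Y r ω)) ∂μ := by
      rw [lintegral_finsetSum _ fun r _ => ((hY r).exp.ennreal_ofReal).const_mul _]
      simp only [lintegral_const_mul' _ _ ENNReal.ofReal_ne_top]
    _ ≤ ∑ _r : ρ, ENNReal.ofReal w * c := by gcongr; exact hI _
    _ = c := by rw [← Finset.sum_mul, ← ENNReal.ofReal_sum_of_nonneg fun _ _ => hw, hw1]; simp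

end HoldsExcept

section Hits

variable {Z ι : Type*}

open Classical in
/-- The number of entries of the sample `S` that lie in `E`, counted with multiplicity. -/
noncomputable def hits (E : Set Z) (S : List Z) : ℕ := S.countP (· ∈ E)

theorem hits_mono {E F : Set Z} (h : E ⊆ F) (S : List Z) : hits E S ≤ hits F S :=
  List.countP_mono_left fun z _ hz => by simpa using h (by simpa using hz)

theorem hits_le_of_sublist (E : Set Z) {S T : List Z} (h : S.Sublist T) : hits E S ≤ hits E T :=
  h.countP_le

open Classical in
theorem hits_filter (E R : Set Z) (S : List Z) :
    hits E (S.filter (· ∈ R)) = hits (R ∩ E) S := by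
  rw [hits, List.countP_filter, hits]
  exact List.countP_congr fun z _ => by simp [and_comm]

theorem card_subtype_mem_of_nodup {I : List ι} [Fintype {i // i ∈ I}] (hI : I.Nodup) :
    Fintype.card {i // i ∈ I} = I.length := by
  classical
  rw [Fintype.card_of_subtype I.toFinset (by simp), List.toFinset_card_of_nodup hI]

open Classical in
theorem hits_map (E : Set Z) {I : List ι} (hI : I.Nodup) (ω : ι → Z) :
    hits E (I.map ω) = #{j : {i // i ∈ I} | ω j ∈ E} := by
  rw [hits, List.countP_map, Function.comp_def, ← List.Nodup.card_eq_countP hI,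
    ← Finset.card_map (Function.Embedding.subtype _)]
  congr 1
  ext i
  simp [and_comm]

theorem measurable_hits_map {Ω : Type*} [MeasurableSpace Ω] [MeasurableSpace Z] {E : Ω → Set Z}
    (hE : MeasurableSet {q : Ω × Z | q.2 ∈ E q.1}) {f : Ω → ι → Z} (hf : ∀ i, Measurable (f · i))
    (I : List ι) : Measurable fun ω => hits (E ω) (I.map (f ω)) := by
  classical
  induction I with
  | nil => simp [hits]
  | cons a I ih =>
    simp only [hits, List.map_cons, List.countP_cons, decide_eq_true_eq]
    exact ih.add (.ite ((measurable_id.prodMk (hf a)) hE) measurable_const measurable_const)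

theorem IsERM.hits_errSet_le {X : Type*} {H : Set (X → Bool)} {A : Learner X} (hA : IsERM H A)
    (S : List (Example X)) {h : X → Bool} (hh : h ∈ H) :
    hits (errSet (A S)) S ≤ hits (errSet h) S := by
  classical
  have hits_eq (g : X → Bool) : S.countP (fun z => g z.1 != z.2) = hits (errSet g) S :=
    List.countP_congr fun z _ => by simp only [bne_iff_ne, decide_eq_true_eq]; rfl
  have hle := (hA S).2 h hh
  rcases S.length.eq_zero_or_pos with h0 | h0
  · simp [List.length_eq_zero_iff.1 h0, hits]
  · rw [empErr, empErr, div_le_div_iff_of_pos_right (by exact_mod_cast h0), hits_eq, hits_eq] at hle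
    exact_mod_cast hle

end Hits

section RandomRegions

variable {X Z ι : Type*}

open Classical in
/-- The family of points with the entries `u` at the indices in `I` and the entries of `v`
elsewhere. -/
noncomputable def overwrite {I : List ι} (u : {i // i ∈ I} → Z) (v : ι → Z) : ι → Z :=
  fun i => if hi : i ∈ I then u ⟨i, hi⟩ else v i

theorem overwrite_coe {I : List ι} (u : {i // i ∈ I} → Z) (v : ι → Z) (j : {i // i ∈ I}) :
    overwrite u v j = u j := by
  simp [overwrite, j.2]

theorem overwrite_of_notMem {I : List ι} (u : {i // i ∈ I} → Z) (v : ι → Z) {i : ι} (hi : i ∉ I) :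
    overwrite u v i = v i := by
  simp [overwrite, hi]

variable [MeasurableSpace Z]

theorem measurable_measureReal_fiber {Ω : Type*} [MeasurableSpace Ω] (D : Measure Z) [SFinite D]
    {E : Ω → Set Z} (hE : MeasurableSet {q : Ω × Z | q.2 ∈ E q.1}) :
    Measurable fun ω => D.real (E ω) :=
  (measurable_measure_prodMk_left hE).ennreal_toReal

theorem measurable_overwrite {I : List ι} (v : ι → Z) :
    Measurable fun u : {i // i ∈ I} → Z => overwrite u v := by
  refine measurable_pi_lambda _ fun i => ?_
  by_cases hi : i ∈ I <;> simp only [overwrite, hi, dite_true, dite_false] <;> fun_prop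

open Classical in
theorem lintegral_pi_le_of_forall_fiber [Fintype ι] (D : Measure Z)
    [IsProbabilityMeasure D] (I : List ι) {F : (ι → Z) → ℝ≥0∞} (hF : Measurable F) {c : ℝ≥0∞}
    (h : ∀ v : ι → Z,
      ∫⁻ u : {i // i ∈ I} → Z, F (overwrite u v) ∂(Measure.pi fun _ => D) ≤ c) :
    ∫⁻ ω, F ω ∂(Measure.pi fun _ : ι => D) ≤ c := by
  have hmp := (measurePreserving_piEquivPiSubtypeProd (fun _ : ι => D) (· ∈ I)).symm
  set e := MeasurableEquiv.piEquivPiSubtypeProd (fun _ : ι => Z) (· ∈ I)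
  obtain ⟨z₀⟩ : Nonempty Z := nonempty_of_isProbabilityMeasure D
  rw [← hmp.lintegral_comp hF, lintegral_prod_symm' (fun p => F (e.symm p))
    (hF.comp e.symm.measurable)]
  have hfiber (v : {i // i ∉ I} → Z) :
      ∫⁻ u, F (e.symm (u, v)) ∂(Measure.pi fun _ : {i // i ∈ I} => D) ≤ c := by
    convert h fun i => if hi : i ∈ I then z₀ else v ⟨i, hi⟩ using 4 with u
    funext i
    by_cases hi : i ∈ I <;>
      simp [e, overwrite, MeasurableEquiv.piEquivPiSubtypeProd, Equiv.piEquivPiSubtypeProd, hi]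
  calc
    _ ≤ ∫⁻ _, c ∂(Measure.pi fun _ : {i // i ∉ I} => D) := by convert lintegral_mono hfiber
    _ = c := by simp

theorem lintegral_exp_hits_sub_le [Fintype ι] (D : Measure Z) [IsProbabilityMeasure D] {E : Set Z}
    (hE : MeasurableSet E) {I : List ι} (hI : I.Nodup) {l κ : ℝ} (hlκ : Real.exp l ≤ 1 + κ * l) :
    ∫⁻ ω, ENNReal.ofReal (Real.exp (l * (hits E (I.map ω) - κ * I.length * D.real E)))
      ∂(Measure.pi fun _ : ι => D) ≤ 1 := by
  classical
  have hitsm := measurable_hits_map (E := fun _ : ι → Z => E) (measurable_snd hE) (f := id)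
    (fun i => measurable_pi_apply i) I
  set p := D.real E
  set q := l * (κ * I.length * p)
  have hp : 0 ≤ p := measureReal_nonneg
  have hbase : 0 ≤ 1 + p * (Real.exp l - 1) :=
    (Real.exp_pos _).le.trans (exp_mul_le_one_add hp measureReal_le_one l)
  have hexp : 1 + p * (Real.exp l - 1) ≤ Real.exp (κ * l * p) := by
    refine le_trans ?_ (Real.add_one_le_exp _)
    linarith [mul_le_mul_of_nonneg_left hlκ hp]
  refine lintegral_pi_le_of_forall_fiber D I (by fun_prop) fun v => ?_
  calc
    _ = ∫⁻ u : {i // i ∈ I} → Z, (∏ j, E.mulIndicator (fun _ => ENNReal.ofReal (Real.exp l)) (u j))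
          * ENNReal.ofReal (Real.exp (-q)) ∂(Measure.pi fun _ => D) := by
      refine lintegral_congr fun u => ?_
      rw [prod_mulIndicator_const, ← ENNReal.ofReal_pow (by positivity),
        ← ENNReal.ofReal_mul (by positivity), ← Real.exp_nat_mul, ← Real.exp_add, hits_map E hI]
      simp only [overwrite_coe, q]
      ring_nf
    _ = ENNReal.ofReal ((1 + p * (Real.exp l - 1)) ^ I.length * Real.exp (-q)) := by
      rw [lintegral_mul_const' _ _ ENNReal.ofReal_ne_top,
        lintegral_pi_prod_mulIndicator D hE (by positivity), card_subtype_mem_of_nodup hI,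
        ← ENNReal.ofReal_pow hbase, ← ENNReal.ofReal_mul (by positivity)]
    _ ≤ ENNReal.ofReal (Real.exp (κ * l * p) ^ I.length * Real.exp (-q)) := by
      gcongr
    _ = 1 := by
      rw [← Real.exp_nat_mul, ← Real.exp_add]
      simp only [q]
      ring_nf
      simp

/- Conditionally on the sample points outside `I` the region is fixed, so the bound for a fixed
region applies fibrewise. -/
theorem lintegral_exp_hits_deviation_le [MeasurableSpace X] [Fintype ι] {H : Set (X → Bool)}
    {d : ℕ} (hd : VCDimLE H d) (D : Measure (Example X)) [IsProbabilityMeasure D] {I : List ι}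
    (hI : I.Nodup)
    {R E : (ι → Example X) → Set (Example X)}
    (hR : MeasurableSet {q : (ι → Example X) × Example X | q.2 ∈ R q.1})
    (hRI : ∀ ω ω', (∀ i ∉ I, ω i = ω' i) → R ω = R ω')
    (hEm : MeasurableSet {q : (ι → Example X) × Example X | q.2 ∈ E q.1})
    (hE : ∀ ω, E ω ∈ errSetsWithin H (R ω)) {l κ η : ℝ}
    (hlκ : Real.exp l + Real.exp (-(κ * l)) ≤ 2) (hη : 0 < η) (hη1 : η ≤ 1) :
    ∫⁻ ω, ENNReal.ofReal (Real.exp (l * (I.length * D.real (E ω) - κ * hits (E ω) (I.map ω))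
      - 2 * η * I.length * D.real (R ω))) ∂(Measure.pi fun _ : ι => D)
      ≤ ENNReal.ofReal (η ^ d)⁻¹ := by
  classical
  have hitsm := measurable_hits_map hEm (f := id) (fun i => measurable_pi_apply i) I
  have hDE := measurable_measureReal_fiber D hEm
  have hDR := measurable_measureReal_fiber D hR
  refine lintegral_pi_le_of_forall_fiber D I (by fun_prop) fun v => ?_
  have hRw (u : {i // i ∈ I} → Example X) : R (overwrite u v) = R v :=
    hRI _ _ fun i hi => overwrite_of_notMem u v hi
  have main := lintegral_exp_deviation_le D hd (R := R v) (measurable_const.prodMk measurable_id hR)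
    (E := fun u => E (overwrite u v))
    (((measurable_overwrite v).comp measurable_fst).prodMk measurable_snd hEm)
    (fun u => hRw u ▸ hE (overwrite u v)) hlκ hη hη1
  have hcount (u : {i // i ∈ I} → Example X) :
        hits (E (overwrite u v)) (I.map (overwrite u v)) = #{j | u j ∈ E (overwrite u v)} := by
    simp only [hits_map _ hI, overwrite_coe]
  rw [card_subtype_mem_of_nodup hI] at main
  set q := 2 * η * I.length * D.real (R v)
  calc
    _ = ∫⁻ u, ENNReal.ofReal (Real.exp (l * (I.length * D.real (E (overwrite u v))
          - κ * #{j | u j ∈ E (overwrite u v)}))) * ENNReal.ofReal (Real.exp (-q)) ∂_ := by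
      refine lintegral_congr fun u => ?_
      rw [← ENNReal.ofReal_mul (by positivity), ← Real.exp_add, ← sub_eq_add_neg, ← hcount, hRw]
    _ ≤ ENNReal.ofReal ((η ^ d)⁻¹ * Real.exp q) * ENNReal.ofReal (Real.exp (-q)) := by
      rw [lintegral_mul_const' _ _ ENNReal.ofReal_ne_top]
      gcongr
    _ = _ := by
      rw [← ENNReal.ofReal_mul (by positivity), mul_assoc, ← Real.exp_add]
      simp

end RandomRegions

section AverageError

variable {X ι : Type*} [MeasurableSpace X]

/-- The average, over the family `v` of classifiers, of the probability to err inside `R`. -/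
noncomputable def avgErrOn (D : Measure (Example X)) {t : ℕ} (v : Fin t → X → Bool)
    (R : Set (Example X)) : ℝ :=
  (∑ r, D.real (R ∩ errSet (v r))) / t

theorem measurableSet_mem_errSet {Ω : Type*} [MeasurableSpace Ω] {g : Ω → X → Bool}
    (hg : Measurable fun p : Ω × X => g p.1 p.2) :
    MeasurableSet {q : Ω × Example X | q.2 ∈ errSet (g q.1)} := by
  have hgz : Measurable fun q : Ω × Example X => g q.1 q.2.1 :=
    hg.comp (measurable_fst.prodMk (measurable_fst.comp measurable_snd))
  exact (measurableSet_eq_fun hgz (measurable_snd.comp measurable_snd)).compl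

variable [Fintype ι] {H : Set (X → Bool)} {d : ℕ}

theorem holdsExcept_avgErrOn_lt (hd : VCDimLE H d) (D : Measure (Example X))
    [IsProbabilityMeasure D] {t : ℕ} (ht : 0 < t) {v : (ι → Example X) → Fin t → X → Bool}
    (hv : ∀ r, Measurable fun p : (ι → Example X) × X => v p.1 r p.2) (hvH : ∀ ω r, v ω r ∈ H)
    {I : Fin t → List ι} {n : ℕ} (hI : ∀ r, (I r).Nodup) (hn : ∀ r, (I r).length = n)
    {R : (ι → Example X) → Set (Example X)}
    (hR : MeasurableSet {q : (ι → Example X) × Example X | q.2 ∈ R q.1})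
    (hRI : ∀ r ω ω', (∀ i ∉ I r, ω i = ω' i) → R ω = R ω') {N : (ι → Example X) → ℕ}
    (hN : ∀ ω r, hits (R ω ∩ errSet (v ω r)) ((I r).map ω) ≤ N ω) {l κ η δ : ℝ} (hl : 0 < l)
    (hκ : 0 ≤ κ) (hlκ : Real.exp l + Real.exp (-(κ * l)) ≤ 2) (hη : 0 < η) (hη1 : η ≤ 1)
    (hδ : 0 < δ) :
    HoldsExcept (Measure.pi fun _ : ι => D) δ fun ω =>
      l * (n * avgErrOn D (v ω) (R ω) - κ * N ω) - 2 * η * n * D.real (R ω)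
        < d * Real.log η⁻¹ + Real.log δ⁻¹ := by
  have : Nonempty (Fin t) := ⟨0, ht⟩
  set E : Fin t → (ι → Example X) → Set (Example X) := fun r ω => R ω ∩ errSet (v ω r)
  have hE r : MeasurableSet {q : (ι → Example X) × Example X | q.2 ∈ E r q.1} :=
    hR.inter (measurableSet_mem_errSet (g := fun ω => v ω r) (hv r))
  set Y : Fin t → (ι → Example X) → ℝ := fun r ω =>
    l * (n * D.real (E r ω) - κ * hits (E r ω) ((I r).map ω)) - 2 * η * n * D.real (R ω)
  have hY r : Measurable (Y r) := by
    have := measurable_measureReal_fiber D (hE r)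
    have := measurable_measureReal_fiber D hR
    have := measurable_hits_map (hE r) (f := id) (fun i => measurable_pi_apply i) (I r)
    fun_prop
  have moment r : ∫⁻ ω, ENNReal.ofReal (Real.exp (Y r ω)) ∂(Measure.pi fun _ : ι => D)
      ≤ ENNReal.ofReal (η ^ d)⁻¹ := by
    simpa only [hn] using lintegral_exp_hits_deviation_le hd D (hI r) hR (hRI r) (hE r)
      (fun ω => ⟨v ω r, hvH ω r, rfl⟩) hlκ hη hη1
  refine (HoldsExcept.of_lintegral_exp_le (by fun_prop) (by positivity)
    (lintegral_exp_average_le hY moment) hδ).mono fun ω hω => ?_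
  have hmean : l * (n * avgErrOn D (v ω) (R ω) - κ * N ω) - 2 * η * n * D.real (R ω)
      ≤ (∑ r, Y r ω) / Fintype.card (Fin t) := by
    have ht' : (0 : ℝ) < t := by exact_mod_cast ht
    calc
      _ = (∑ r, (l * (n * D.real (E r ω) - κ * N ω) - 2 * η * n * D.real (R ω))) / t := by
        simp only [Finset.sum_sub_distrib, ← Finset.mul_sum, Finset.sum_const, avgErrOn, E,
          Finset.card_univ, Fintype.card_fin, nsmul_eq_mul]
        field_simp
      _ ≤ _ := by
        rw [Fintype.card_fin]
        gcongr with r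
        simp only [Y]
        gcongr
        exact hN ω r
  refine hmean.trans_lt (hω.trans_eq ?_)
  rw [div_eq_mul_inv, Real.log_mul (by positivity) (by positivity), ← inv_pow, Real.log_pow]

theorem exp_le_one_add_add_sq {x : ℝ} (hx : |x| ≤ 1) : Real.exp x ≤ 1 + x + x ^ 2 := by
  linarith [(abs_le.1 (Real.abs_exp_sub_one_sub_id_le hx)).2]

theorem exp_add_exp_neg_le_two :
    Real.exp (1 / 30000) + Real.exp (-(1.0001 * (1 / 30000))) ≤ 2 := by
  have h₁ := exp_le_one_add_add_sq (x := 1 / 30000) (by norm_num [abs_of_pos])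
  have h₂ := exp_le_one_add_add_sq (x := -(1.0001 * (1 / 30000))) (by norm_num [abs_of_pos])
  norm_num at h₁ h₂ ⊢
  linarith

theorem log_ten_pow_le : Real.log (10 ^ 23) ≤ 54 := by
  calc
    Real.log (10 ^ 23) ≤ Real.log (2 ^ 77) := Real.log_le_log (by norm_num) (by norm_num)
    _ = 77 * Real.log 2 := by rw [Real.log_pow]; norm_num
    _ ≤ 54 := by linarith [Real.log_two_lt_d9]

theorem holdsExcept_avgErrOn_le (hd : VCDimLE H d) (D : Measure (Example X))
    [IsProbabilityMeasure D] {t : ℕ} (ht : 0 < t) {v : (ι → Example X) → Fin t → X → Bool}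
    (hv : ∀ r, Measurable fun p : (ι → Example X) × X => v p.1 r p.2) (hvH : ∀ ω r, v ω r ∈ H)
    {I : Fin t → List ι} {n : ℕ} (hI : ∀ r, (I r).Nodup) (hn : ∀ r, (I r).length = n)
    {R : (ι → Example X) → Set (Example X)}
    (hR : MeasurableSet {q : (ι → Example X) × Example X | q.2 ∈ R q.1})
    (hRI : ∀ r ω ω', (∀ i ∉ I r, ω i = ω' i) → R ω = R ω') {N : (ι → Example X) → ℕ}
    (hN : ∀ ω r, hits (R ω ∩ errSet (v ω r)) ((I r).map ω) ≤ N ω) {δ : ℝ} (hδ : 0 < δ) :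
    HoldsExcept (Measure.pi fun _ : ι => D) δ fun ω =>
      n * avgErrOn D (v ω) (R ω)
        ≤ 1.0001 * N ω + n * D.real (R ω) / 10 ^ 18 + 30000 * (54 * d + Real.log δ⁻¹) := by
  refine (holdsExcept_avgErrOn_lt hd D ht hv hvH hI hn hR hRI hN (l := 1 / 30000) (κ := 1.0001)
    (η := (10 ^ 23)⁻¹) (by norm_num) (by norm_num) exp_add_exp_neg_le_two (by norm_num)
    (by norm_num) hδ).mono fun ω hω => ?_
  have hR0 : 0 ≤ n * D.real (R ω) := by positivity
  rw [inv_inv, mul_assoc (2 * _)] at hω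
  replace hω := hω.trans_le
    (add_le_add_left (mul_le_mul_of_nonneg_left log_ten_pow_le d.cast_nonneg) _)
  norm_num at hω ⊢
  linarith

theorem holdsExcept_hits_le {Z : Type*} [MeasurableSpace Z] (D : Measure Z)
    [IsProbabilityMeasure D] {E : Set Z} (hE : MeasurableSet E) {I : List ι} (hI : I.Nodup)
    {l κ δ : ℝ} (hlκ : Real.exp l ≤ 1 + κ * l) (hδ : 0 < δ) :
    HoldsExcept (Measure.pi fun _ : ι => D) δ fun ω =>
      l * (hits E (I.map ω) - κ * I.length * D.real E) < Real.log δ⁻¹ := by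
  have hitsm := measurable_hits_map (E := fun _ : ι → Z => E) (measurable_snd hE) (f := id)
    (fun i => measurable_pi_apply i) I
  have moment := lintegral_exp_hits_sub_le D hE hI hlκ
  rw [← ENNReal.ofReal_one] at moment
  simpa only [one_div] using HoldsExcept.of_lintegral_exp_le (by fun_prop) one_pos moment hδ

end AverageError

section Splitting

variable {α β : Type*}

theorem block_sublist (S : List α) (i n : ℕ) : (block S i n).Sublist S :=
  (List.take_sublist _ _).trans (List.drop_sublist _ _)

theorem block_map (f : α → β) (S : List α) (i n : ℕ) :
    block (S.map f) i n = (block S i n).map f := by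
  simp [block, List.map_take, List.map_drop]

theorem length_block {S : List α} {i n q : ℕ} (hS : S.length = q * n) (hi : i < q) :
    (block S i n).length = n := by
  have := Nat.mul_le_mul_right n hi
  rw [Nat.succ_mul] at this
  simp only [block, List.length_take, List.length_drop, hS]
  omega

theorem disjoint_block {S : List α} (hS : S.Nodup) {i j : ℕ} (hij : i ≠ j) (n : ℕ) :
    List.Disjoint (block S i n) (block S j n) := by
  wlog h : i < j generalizing i j
  · exact (this hij.symm (by omega)).symm
  have block_eq_drop : block S i n = (S.take ((i + 1) * n)).drop (i * n) := by
    rw [block, add_mul, one_mul, List.drop_take, add_tsub_cancel_left]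
  have block_subset_take : block S i n ⊆ S.take ((i + 1) * n) :=
    block_eq_drop ▸ List.drop_subset _ _
  exact fun a ha hb => List.disjoint_take_drop hS (Nat.mul_le_mul_right n h)
    (block_subset_take ha) (List.take_subset _ _ hb)

/-- The first `3 ^ k` entries of the `i`-th block of length `3 ^ (k + 3)` of `S`. -/
def blockHead (k : ℕ) (S : List α) (i : ℕ) : List α := (block S i (3 ^ (k + 3))).take (3 ^ k)

/-- The entries of the `i`-th block of length `3 ^ (k + 3)` of `S` after the first `3 ^ k`. -/
def blockTail (k : ℕ) (S : List α) (i : ℕ) : List α := (block S i (3 ^ (k + 3))).drop (3 ^ k)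

theorem blockHead_append_blockTail (k : ℕ) (S : List α) (i : ℕ) :
    blockHead k S i ++ blockTail k S i = block S i (3 ^ (k + 3)) :=
  List.take_append_drop _ _

theorem blockHead_append_blockTail_append (k : ℕ) (S T : List α) (i : ℕ) :
    blockHead k S i ++ (blockTail k S i ++ T) = block S i (3 ^ (k + 3)) ++ T := by
  rw [← List.append_assoc, blockHead_append_blockTail]

theorem blockHead_append_sublist (k : ℕ) (S T : List α) (i : ℕ) :
    (blockHead k S i ++ (blockTail k S i ++ T)).Sublist (S ++ T) := by
  rw [blockHead_append_blockTail_append]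
  exact (block_sublist _ _ _).append_right T

theorem blockTail_sublist_block (k : ℕ) (S : List α) (i : ℕ) :
    (blockTail k S i).Sublist (block S i (3 ^ (k + 3))) :=
  List.drop_sublist _ _

theorem blockTail_sublist (k : ℕ) (S : List α) (i : ℕ) : (blockTail k S i).Sublist S :=
  (blockTail_sublist_block k S i).trans (block_sublist _ _ _)

theorem blockHead_map (f : α → β) (k : ℕ) (S : List α) (i : ℕ) :
    blockHead k (S.map f) i = (blockHead k S i).map f := by
  simp [blockHead, block_map, List.map_take]

theorem blockTail_map (f : α → β) (k : ℕ) (S : List α) (i : ℕ) :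
    blockTail k (S.map f) i = (blockTail k S i).map f := by
  simp [blockTail, block_map, List.map_drop]

theorem length_block_three_pow {k : ℕ} {S : List α} (hS : S.length = 3 ^ (k + 6)) (i : Fin 27) :
    (block S i (3 ^ (k + 3))).length = 3 ^ (k + 3) :=
  length_block (q := 27) (hS.trans (by ring)) i.2

theorem length_blockHead {k : ℕ} {S : List α} (hS : S.length = 3 ^ (k + 6)) (i : Fin 27) :
    (blockHead k S i).length = 3 ^ k := by
  rw [blockHead, List.length_take, length_block_three_pow hS,
    min_eq_left (Nat.pow_le_pow_right three_pos (by omega))]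

theorem length_blockTail {k : ℕ} {S : List α} (hS : S.length = 3 ^ (k + 6)) (i : Fin 27) :
    (blockTail k S i).length = 26 * 3 ^ k := by
  rw [blockTail, List.length_drop, length_block_three_pow hS, pow_add]
  omega

theorem splitting_add_six (k : ℕ) (S T : List α) :
    splitting (k + 6) S T = (List.range 27).flatMap fun i =>
      splitting k (blockHead k S i) (blockTail k S i ++ T) := rfl

theorem splitting_map (f : α → β) (k : ℕ) (S T : List α) :
    splitting k (S.map f) (T.map f) = (splitting k S T).map (List.map f) := by
  induction k, S, T using splitting.induct with
  | case1 k S T ih =>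
    rw [splitting_add_six, splitting_add_six, List.map_flatMap]
    congr 1
    funext i
    rw [blockHead_map, blockTail_map, ← List.map_append]
    exact ih i
  | _ => simp [splitting]

theorem sublist_of_mem_splitting {k : ℕ} {S T S' : List α} (hS' : S' ∈ splitting k S T) :
    S'.Sublist (S ++ T) := by
  induction k, S, T using splitting.induct with
  | case1 k S T ih =>
    obtain ⟨i, -, hi⟩ := List.mem_flatMap.1 (splitting_add_six k S T ▸ hS')
    refine (ih i hi).trans ?_
    rw [← List.append_assoc, List.take_append_drop]
    exact (block_sublist _ _ _).append (List.Sublist.refl _)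
  | _ => simp_all [splitting]

theorem suffix_of_mem_splitting {k : ℕ} {S T S' : List α} (hS' : S' ∈ splitting k S T) :
    T <:+ S' := by
  induction k, S, T using splitting.induct with
  | case1 k S T ih =>
    obtain ⟨i, -, hi⟩ := List.mem_flatMap.1 (splitting_add_six k S T ▸ hS')
    exact (List.suffix_append _ _).trans (ih i hi)
  | _ => simp_all [splitting]

theorem exists_block_of_mem_splitting {k : ℕ} {S S' : List α} (hS' : S' ∈ splitting (k + 6) S []) :
    ∃ i : Fin 27, (blockTail k S i).Sublist S' ∧ S'.Sublist (block S i (3 ^ (k + 3))) := by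
  obtain ⟨i, hi, hS'⟩ := List.mem_flatMap.1 (splitting_add_six k S [] ▸ hS')
  refine ⟨⟨i, List.mem_range.1 hi⟩, ?_, ?_⟩
  · simpa using (suffix_of_mem_splitting hS').sublist
  · simpa [blockHead_append_blockTail] using sublist_of_mem_splitting hS'

/-- The `r`-th member of the splitting family. -/
def leaf (k : ℕ) (S T : List α) (r : Fin (27 ^ (k / 6))) : List α :=
  (splitting k S T).get (Fin.cast (length_splitting k S T).symm r)

theorem leaf_mem (k : ℕ) (S T : List α) (r : Fin (27 ^ (k / 6))) :
    leaf k S T r ∈ splitting k S T :=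
  List.get_mem _ _

theorem leaf_map (f : α → β) (k : ℕ) (S T : List α) (r : Fin (27 ^ (k / 6))) :
    leaf k (S.map f) (T.map f) r = (leaf k S T r).map f := by
  simp [leaf, splitting_map]

theorem sum_leaf {M : Type*} [AddCommMonoid M] (f : List α → M) (k : ℕ) (S T : List α) :
    ∑ r, f (leaf k S T r) = ((splitting k S T).map f).sum := by
  rw [← Fin.sum_univ_fun_getElem, ← (finCongr (length_splitting k S T)).sum_comp]
  rfl

theorem sum_leaf_add_six {M : Type*} [AddCommMonoid M] (f : List α → M) (k : ℕ) (S T : List α) :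
    ∑ r, f (leaf (k + 6) S T r) = ∑ i : Fin 27, ∑ r,
      f (leaf k (blockHead k S i) (blockTail k S i ++ T) r) := by
  simp only [sum_leaf, splitting_add_six]
  rw [List.map_flatMap, List.flatMap_def, List.sum_flatten, List.map_map,
    ← List.map_coe_finRange_eq_range, List.map_map, ← Fin.sum_univ_def]
  rfl

end Splitting

section ErrRegion

variable {X : Type*} {t : ℕ}

/-- The examples on which at least a fraction `θ` of the classifiers in `v` errs. -/
def errRegion (v : Fin t → X → Bool) (θ : ℝ) : Set (Example X) := {z | θ ≤ avgNe v z.1 z.2}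

theorem errRegion_anti (v : Fin t → X → Bool) {θ θ' : ℝ} (h : θ ≤ θ') :
    errRegion v θ' ⊆ errRegion v θ :=
  fun _ hz => h.trans hz

theorem avgNe_eq_sum_indicator (v : Fin t → X → Bool) (z : Example X) :
    avgNe v z.1 z.2 = (∑ r, (errSet (v r)).indicator 1 z) / t := by
  classical
  rw [avgNe, Finset.card_filter, Nat.cast_sum]
  congr! 2 with r
  rw [indicator_apply, Nat.cast_ite, Nat.cast_one, Nat.cast_zero]
  exact if_congr Iff.rfl rfl rfl

theorem avgNe_le_one (v : Fin t → X → Bool) (x : X) (y : Bool) : avgNe v x y ≤ 1 :=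
  div_le_one_of_le₀ (by exact_mod_cast (Finset.card_le_univ _).trans_eq (Fintype.card_fin t))
    t.cast_nonneg

theorem exists_le_and_le_sum_erase {κ : Type*} [Fintype κ] [DecidableEq κ] [Nonempty κ] {a : κ → ℝ}
    (ha : ∀ i, a i ≤ 1) {θ : ℝ} (hθ : θ ≤ (∑ i, a i) / Fintype.card κ) :
    ∃ i, θ ≤ a i ∧ Fintype.card κ * θ - 1 ≤ ∑ j ∈ Finset.univ.erase i, a j := by
  rw [le_div_iff₀' (by positivity)] at hθ
  obtain ⟨i, -, hi⟩ := Finset.exists_le_of_sum_le (s := Finset.univ) (f := fun _ => θ) (g := a)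
    Finset.univ_nonempty (by simpa using hθ)
  refine ⟨i, hi, ?_⟩
  linarith [Finset.add_sum_erase Finset.univ a (Finset.mem_univ i), ha i]

variable [MeasurableSpace X]

theorem measurable_avgNe {Ω : Type*} [MeasurableSpace Ω] {v : Ω → Fin t → X → Bool}
    (hv : ∀ r, Measurable fun p : Ω × X => v p.1 r p.2) :
    Measurable fun q : Ω × Example X => avgNe (v q.1) q.2.1 q.2.2 := by
  simp only [avgNe_eq_sum_indicator]
  refine (Finset.measurable_sum _ fun r _ => ?_).div_const _
  exact measurable_const.indicator (measurableSet_mem_errSet (g := fun ω => v ω r) (hv r))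

theorem measurableSet_mem_errRegion {Ω : Type*} [MeasurableSpace Ω] {v : Ω → Fin t → X → Bool}
    (hv : ∀ r, Measurable fun p : Ω × X => v p.1 r p.2) (θ : ℝ) :
    MeasurableSet {q : Ω × Example X | q.2 ∈ errRegion (v q.1) θ} :=
  measurableSet_le measurable_const (measurable_avgNe hv)

variable (D : Measure (Example X)) [IsFiniteMeasure D]

theorem avgErrOn_eq_setIntegral {v : Fin t → X → Bool} (hv : ∀ r, MeasurableSet (errSet (v r)))
    (R : Set (Example X)) : avgErrOn D v R = ∫ z in R, avgNe v z.1 z.2 ∂D := by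
  simp only [avgNe_eq_sum_indicator, integral_div]
  rw [integral_finsetSum _ fun r _ => (integrable_const 1).indicator (hv r)]
  simp only [integral_indicator_one (hv _), measureReal_restrict_apply (hv _), inter_comm, avgErrOn]

theorem integrable_avgNe {v : Fin t → X → Bool} (hv : ∀ r, MeasurableSet (errSet (v r))) :
    Integrable (fun z => avgNe v z.1 z.2) D := by
  simp only [avgNe_eq_sum_indicator]
  exact (integrable_finsetSum _ fun r _ => (integrable_const 1).indicator (hv r)).div_const _

theorem mul_measureReal_le_sum_avgErrOn {κ : Type*} (s : Finset κ) {v : κ → Fin t → X → Bool}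
    (hv : ∀ j r, MeasurableSet (errSet (v j r))) {R : Set (Example X)} (hR : MeasurableSet R)
    (θ : ℝ) :
    θ * D.real ({z | θ ≤ ∑ j ∈ s, avgNe (v j) z.1 z.2} ∩ R) ≤ ∑ j ∈ s, avgErrOn D (v j) R := by
  have hint j : IntegrableOn (fun z => avgNe (v j) z.1 z.2) R D :=
    (integrable_avgNe D (hv j)).integrableOn
  have nonneg (z : Example X) : 0 ≤ ∑ j ∈ s, avgNe (v j) z.1 z.2 :=
    Finset.sum_nonneg fun j _ => by unfold avgNe; positivity
  rw [← measureReal_restrict_apply' hR]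
  calc
    _ ≤ ∫ z in R, ∑ j ∈ s, avgNe (v j) z.1 z.2 ∂D :=
      mul_meas_ge_le_integral_of_nonneg (.of_forall nonneg)
        (integrable_finsetSum _ fun j _ => hint j) θ
    _ = _ := by
      rw [integral_finsetSum _ fun j _ => hint j]
      simp only [avgErrOn_eq_setIntegral D (hv _)]

theorem mul_measureReal_errRegion_le {κ : Type*} [Fintype κ] [DecidableEq κ] [Nonempty κ] {s : ℕ}
    {u : Fin s → X → Bool} {v : κ → Fin t → X → Bool}
    (huv : ∀ x y, avgNe u x y = (∑ i, avgNe (v i) x y) / Fintype.card κ)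
    (hv : ∀ i r, MeasurableSet (errSet (v i r))) {θ : ℝ}
    (hR : ∀ i, MeasurableSet (errRegion (v i) θ)) (hθ : 1 ≤ Fintype.card κ * θ) :
    (Fintype.card κ * θ - 1) * D.real (errRegion u θ)
      ≤ ∑ i, ∑ j ∈ Finset.univ.erase i, avgErrOn D (v j) (errRegion (v i) θ) := by
  set c := Fintype.card κ * θ - 1
  have hc : 0 ≤ c := sub_nonneg.2 hθ
  have cover : errRegion u θ ⊆ ⋃ i, {z | c ≤ ∑ j ∈ Finset.univ.erase i, avgNe (v j) z.1 z.2}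
      ∩ errRegion (v i) θ := fun z hz => by
    obtain ⟨i, hi, hrest⟩ := exists_le_and_le_sum_erase (fun i => avgNe_le_one (v i) z.1 z.2)
      (hz.trans_eq (huv z.1 z.2))
    exact mem_iUnion.2 ⟨i, hrest, hi⟩
  calc
    _ ≤ c * ∑ i, D.real ({z | c ≤ ∑ j ∈ Finset.univ.erase i, avgNe (v j) z.1 z.2}
          ∩ errRegion (v i) θ) := by
      gcongr
      exact (measureReal_mono cover).trans (measureReal_iUnion_fintype_le _)
    _ ≤ _ := by
      rw [Finset.mul_sum]
      gcongr with i
      exact mul_measureReal_le_sum_avgErrOn D _ hv (hR i) c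

end ErrRegion

section Leaves

variable {X ι : Type*}

/-- The classifiers that the learner `A` produces from the members of the splitting family. -/
def leaves (A : Learner X) (k : ℕ) (S T : List (Example X)) : Fin (27 ^ (k / 6)) → X → Bool :=
  fun r => A (leaf k S T r)

theorem leaves_map (A : Learner X) (k : ℕ) (S T : List ι) (ω : ι → Example X) :
    leaves A k (S.map ω) (T.map ω) = fun r => A ((leaf k S T r).map ω) :=
  funext fun r => congrArg A (leaf_map ω k S T r)

theorem avgNe_leaves_add_six (A : Learner X) (k : ℕ) (S T : List (Example X)) (x : X) (y : Bool) :
    avgNe (leaves A (k + 6) S T) x y = (∑ i : Fin 27,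
      avgNe (leaves A k (blockHead k S i) (blockTail k S i ++ T)) x y) / Fintype.card (Fin 27) := by
  have hsum := sum_leaf_add_six (fun S' => (errSet (A S')).indicator (1 : Example X → ℝ) (x, y))
    k S T
  have avgNe_eq {t : ℕ} (v : Fin t → X → Bool) := avgNe_eq_sum_indicator v (x, y)
  simp only [avgNe_eq, leaves, hsum, ← Finset.sum_div, div_div, Fintype.card_fin,
    Nat.add_div_right k (show 0 < 6 by norm_num), pow_succ]
  norm_num

variable [MeasurableSpace X]

theorem measurable_learner_map {A : Learner X} (hAm : MeasurableLearner A) (I : List ι) :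
    Measurable fun p : (ι → Example X) × X => A (I.map p.1) p.2 := by
  have map_eq_ofFn (ω : ι → Example X) : I.map ω = List.ofFn fun j => ω (I.get j) :=
    List.ext_get (by simp) (by simp)
  simp_rw [map_eq_ofFn]
  refine (hAm I.length).comp (Measurable.prodMk ?_ measurable_snd)
  exact measurable_pi_lambda _ fun j => (measurable_pi_apply _).comp measurable_fst

theorem measurable_leaves_map {A : Learner X} (hAm : MeasurableLearner A) (k : ℕ) (S T : List ι)
    (r : Fin (27 ^ (k / 6))) :
    Measurable fun p : (ι → Example X) × X => leaves A k (S.map p.1) (T.map p.1) r p.2 := by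
  simpa only [leaves_map] using measurable_learner_map hAm (leaf k S T r)

end Leaves

section Recursion

variable {X ι : Type*}

/-- The classifiers that the learner `A` produces from those members of the splitting family of
level `k + 6` that come from the `i`-th block of `S`. -/
def blockLeaves (A : Learner X) (k : ℕ) (S T : List (Example X)) (i : Fin 27) :
    Fin (27 ^ (k / 6)) → X → Bool :=
  leaves A k (blockHead k S i) (blockTail k S i ++ T)

theorem blockLeaves_map (A : Learner X) (k : ℕ) (S T : List ι) (ω : ι → Example X) (i : Fin 27) :
    blockLeaves A k (S.map ω) (T.map ω) i
      = leaves A k ((blockHead k S i).map ω) ((blockTail k S i ++ T).map ω) := by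
  rw [blockLeaves, blockHead_map, blockTail_map, List.map_append]

variable [MeasurableSpace X]

theorem MeasurableLearner.measurable {A : Learner X} (hAm : MeasurableLearner A)
    (S : List (Example X)) : Measurable (A S) := by
  have h : Measurable fun x => A (List.ofFn S.get) x :=
    (hAm S.length).comp (measurable_prodMk_left (x := S.get))
  rwa [List.ofFn_get] at h

theorem measurableSet_errSet {h : X → Bool} (hh : Measurable h) : MeasurableSet (errSet h) :=
  (measurableSet_eq_fun (hh.comp measurable_fst) measurable_snd).compl

theorem measurableSet_errRegion {t : ℕ} {v : Fin t → X → Bool} (hv : ∀ r, Measurable (v r))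
    (θ : ℝ) : MeasurableSet (errRegion v θ) :=
  measurable_prodMk_left (x := ()) <| measurableSet_mem_errRegion (v := fun _ => v)
    (fun r => (hv r).comp measurable_snd) θ

theorem measureReal_errRegion_leaves_add_six_le {A : Learner X} (hA : ∀ S, Measurable (A S))
    (D : Measure (Example X)) [IsFiniteMeasure D] {k : ℕ} {S T : List (Example X)} {a : ℝ}
    (ha : ∀ i j, i ≠ j → 26 * 3 ^ k *
      avgErrOn D (blockLeaves A k S T j) (errRegion (blockLeaves A k S T i) (10 / 243)) ≤ a) :
    3 ^ (k + 6) * D.real (errRegion (leaves A (k + 6) S T) (10 / 243)) ≤ 3 ^ 11 * a := by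
  have hmul := mul_measureReal_errRegion_le D (v := blockLeaves A k S T) (θ := 10 / 243)
    (avgNe_leaves_add_six A k S T)
    (fun _ _ => measurableSet_errSet (hA _)) (fun _ => measurableSet_errRegion (fun _ => hA _) _)
    (by norm_num)
  have hsum : ∑ i, ∑ j ∈ Finset.univ.erase i, 26 * 3 ^ k *
      avgErrOn D (blockLeaves A k S T j) (errRegion (blockLeaves A k S T i) (10 / 243))
      ≤ ∑ _i : Fin 27, 26 * a := by
    refine Finset.sum_le_sum fun i _ => ?_
    refine (Finset.sum_le_card_nsmul _ _ a fun j hj => ?_).trans_eq (by simp)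
    exact ha i j (Finset.ne_of_mem_erase hj).symm
  simp only [← Finset.mul_sum, Finset.sum_const, Finset.card_univ, Fintype.card_fin, nsmul_eq_mul,
    Nat.cast_ofNat] at hmul hsum
  calc
    _ = 3 ^ 8 * 3 ^ k * ((27 * (10 / 243) - 1)
        * D.real (errRegion (leaves A (k + 6) S T) (10 / 243))) := by ring
    _ ≤ 3 ^ 8 * 3 ^ k * _ := mul_le_mul_of_nonneg_left hmul (by positivity)
    _ ≤ 3 ^ 11 * a := by linarith

variable [Fintype ι] {H : Set (X → Bool)} {d : ℕ} {A : Learner X} {h₀ : X → Bool}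

theorem holdsExcept_avgErrOn_learner_le (hd : VCDimLE H d) (hA : IsERM H A)
    (hAm : MeasurableLearner A) (D : Measure (Example X)) [IsProbabilityMeasure D] (hh₀ : h₀ ∈ H)
    {t : ℕ} (ht : 0 < t) {I L : Fin t → List ι} {n : ℕ} (hI : ∀ r, (I r).Nodup)
    (hn : ∀ r, (I r).length = n) (hIL : ∀ r, (I r).Sublist (L r))
    {R : (ι → Example X) → Set (Example X)}
    (hR : MeasurableSet {q : (ι → Example X) × Example X | q.2 ∈ R q.1})
    (hRI : ∀ r ω ω', (∀ i ∉ I r, ω i = ω' i) → R ω = R ω') {N : (ι → Example X) → ℕ}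
    (hN : ∀ ω r, hits (errSet h₀) ((L r).map ω) ≤ N ω) {δ : ℝ} (hδ : 0 < δ) :
    HoldsExcept (Measure.pi fun _ : ι => D) δ fun ω =>
      n * avgErrOn D (fun r => A ((L r).map ω)) (R ω)
        ≤ 1.0001 * N ω + n * D.real (R ω) / 10 ^ 18 + 30000 * (54 * d + Real.log δ⁻¹) := by
  refine holdsExcept_avgErrOn_le hd D ht (fun r => measurable_learner_map hAm (L r))
    (fun ω r => (hA _).1) hI hn hR hRI (fun ω r => ?_) hδ
  calc
    _ ≤ hits (errSet (A ((L r).map ω))) ((I r).map ω) := hits_mono inter_subset_right _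
    _ ≤ hits (errSet (A ((L r).map ω))) ((L r).map ω) := hits_le_of_sublist _ ((hIL r).map ω)
    _ ≤ hits (errSet h₀) ((L r).map ω) := hA.hits_errSet_le _ hh₀
    _ ≤ N ω := hN ω r

theorem holdsExcept_avgErrOn_blockLeaves_le (hd : VCDimLE H d) (hA : IsERM H A)
    (hAm : MeasurableLearner A) (D : Measure (Example X)) [IsProbabilityMeasure D] (hh₀ : h₀ ∈ H)
    {k : ℕ} {S T : List ι} (hS : S.length = 3 ^ (k + 6)) (hST : (S ++ T).Nodup) {i j : Fin 27}
    (hij : i ≠ j) (θ : ℝ) {δ : ℝ} (hδ : 0 < δ) :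
    HoldsExcept (Measure.pi fun _ : ι => D) δ fun ω =>
      26 * 3 ^ k * avgErrOn D (blockLeaves A k (S.map ω) (T.map ω) j)
          (errRegion (blockLeaves A k (S.map ω) (T.map ω) i) θ)
        ≤ 1.0001 * hits (errSet h₀) ((S ++ T).map ω)
          + 26 * 3 ^ k * D.real (errRegion (blockLeaves A k (S.map ω) (T.map ω) i) θ) / 10 ^ 18
          + 30000 * (54 * d + Real.log δ⁻¹) := by
  have hSn := (List.nodup_append.1 hST).1
  have fresh a (ha : a ∈ blockHead k S i ++ (blockTail k S i ++ T)) : a ∉ blockTail k S j := by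
    rw [blockHead_append_blockTail_append, List.mem_append] at ha
    intro haj
    refine ha.elim (fun ha => ?_) fun ha => ?_
    · exact disjoint_block hSn (Fin.val_ne_of_ne hij) _ ha
        ((blockTail_sublist_block k S j).subset haj)
    · exact List.disjoint_of_nodup_append hST ((blockTail_sublist k S j).subset haj) ha
  have hRI ω ω' (hω : ∀ a ∉ blockTail k S j, ω a = ω' a) :
      errRegion (blockLeaves A k (S.map ω) (T.map ω) i) θ
        = errRegion (blockLeaves A k (S.map ω') (T.map ω') i) θ := by
    rw [blockLeaves_map, blockLeaves_map,
      List.map_congr_left fun a ha => hω a (fresh a (List.mem_append_left _ ha)),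
      List.map_congr_left fun a ha => hω a (fresh a (List.mem_append_right _ ha))]
  have hR : MeasurableSet {q : (ι → Example X) × Example X |
      q.2 ∈ errRegion (blockLeaves A k (S.map q.1) (T.map q.1) i) θ} := by
    simp only [blockLeaves_map]
    exact measurableSet_mem_errRegion (v := fun ω =>
      leaves A k ((blockHead k S i).map ω) ((blockTail k S i ++ T).map ω))
      (measurable_leaves_map hAm k _ _) θ
  have tail_sublist r : (blockTail k S j).Sublist
      (leaf k (blockHead k S j) (blockTail k S j ++ T) r) :=
    (List.sublist_append_left _ T).trans (suffix_of_mem_splitting (leaf_mem _ _ _ r)).sublist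
  have sublist_whole r : (leaf k (blockHead k S j) (blockTail k S j ++ T) r).Sublist (S ++ T) :=
    (sublist_of_mem_splitting (leaf_mem _ _ _ r)).trans (blockHead_append_sublist k S T j)
  have h := holdsExcept_avgErrOn_learner_le hd hA hAm D hh₀ (t := 27 ^ (k / 6)) (by positivity)
    (I := fun _ => blockTail k S j) (n := 26 * 3 ^ k)
    (fun _ => hSn.sublist (blockTail_sublist k S j)) (fun _ => length_blockTail hS j)
    tail_sublist hR (fun _ => hRI) (N := fun ω => hits (errSet h₀) ((S ++ T).map ω))
    (fun ω r => hits_le_of_sublist _ ((sublist_whole r).map ω)) hδ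
  simpa only [blockLeaves_map A k S T _ j, leaves_map, Nat.cast_mul, Nat.cast_pow,
    Nat.cast_ofNat] using h

theorem log_inv_div_le {c δ : ℝ} (hc : 0 < c) (hc7 : c ≤ 1096) (hδ : 0 < δ) :
    Real.log (δ / c)⁻¹ ≤ 7 + Real.log δ⁻¹ := by
  have log_le : Real.log c ≤ 7 := by
    rw [Real.log_le_iff_le_exp hc]
    calc
      c ≤ 2.7182818283 ^ 7 := hc7.trans (by norm_num)
      _ ≤ Real.exp 1 ^ 7 := by gcongr; exact Real.exp_one_gt_d9.le
      _ = Real.exp 7 := by rw [← Real.exp_nat_mul]; norm_num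
  rw [inv_div, Real.log_div hc.ne' hδ.ne', Real.log_inv]
  linarith

theorem holdsExcept_measureReal_errRegion_leaves_le (hd : VCDimLE H d) (hA : IsERM H A)
    (hAm : MeasurableLearner A) (D : Measure (Example X)) [IsProbabilityMeasure D] (hh₀ : h₀ ∈ H)
    {k : ℕ} {S T : List ι} (hS : S.length = 3 ^ k) (hST : (S ++ T).Nodup) {δ : ℝ} (hδ : 0 < δ)
    (hδ1 : δ ≤ 1) :
    HoldsExcept (Measure.pi fun _ : ι => D) δ fun ω =>
      3 ^ k * D.real (errRegion (leaves A k (S.map ω) (T.map ω)) (10 / 243))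
        ≤ 10 ^ 12 * (hits (errSet h₀) ((S ++ T).map ω) + d + (1 + Real.log δ⁻¹)) := by
  induction k using Nat.strong_induction_on generalizing S T δ with
  | _ k ih
  have hlog : 0 ≤ Real.log δ⁻¹ := Real.log_nonneg (one_le_inv_iff₀.2 ⟨hδ, hδ1⟩)
  rcases lt_or_ge k 6 with hk | hk
  · refine .of_forall hδ.le fun ω => ?_
    calc
      _ ≤ (3 : ℝ) ^ 6 * 1 := by
        gcongr
        · norm_num
        · exact measureReal_le_one
      _ ≤ 10 ^ 12 * (0 + 0 + (1 + 0)) := by norm_num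
      _ ≤ _ := by gcongr <;> positivity
  obtain ⟨k, rfl⟩ := Nat.exists_eq_add_of_le' hk
  have regions := HoldsExcept.forall_of_fintype fun i : Fin 27 =>
    ih k (by omega) (length_blockHead hS i) (hST.sublist (blockHead_append_sublist k S T i))
      (δ := δ / 1000) (by positivity) (by linarith)
  have errors := HoldsExcept.forall_of_ne (fun i j (hij : i ≠ j) =>
    holdsExcept_avgErrOn_blockLeaves_le hd hA hAm D hh₀ hS hST hij (10 / 243) (δ := δ / 1000)
      (by positivity)) (by positivity)
  rw [Fintype.card_fin] at regions errors
  refine ((regions.and errors).mono_prob (by push_cast; linarith)).mono fun ω ⟨hreg, herr⟩ => ?_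
  have pair i j (hij : i ≠ j) : 26 * 3 ^ k * avgErrOn D (blockLeaves A k (S.map ω) (T.map ω) j)
      (errRegion (blockLeaves A k (S.map ω) (T.map ω) i) (10 / 243))
      ≤ 2 * 10 ^ 6 * (hits (errSet h₀) ((S ++ T).map ω) + d + (1 + Real.log δ⁻¹)) := by
    have hi := hreg i
    rw [← blockLeaves_map] at hi
    have hits_le : (hits (errSet h₀) ((blockHead k S i ++ (blockTail k S i ++ T)).map ω) : ℝ)
        ≤ hits (errSet h₀) ((S ++ T).map ω) := by
      exact_mod_cast hits_le_of_sublist _ ((blockHead_append_sublist k S T i).map ω)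
    linarith [herr i j hij, log_inv_div_le (c := 1000) (by norm_num) (by norm_num) hδ,
      d.cast_nonneg (α := ℝ), (hits (errSet h₀) ((S ++ T).map ω)).cast_nonneg (α := ℝ)]
  refine (measureReal_errRegion_leaves_add_six_le hAm.measurable D pair).trans ?_
  rw [← mul_assoc]
  gcongr
  norm_num

end Recursion

section Sampling

variable {X : Type*} {M t : ℕ}

theorem avgNe_comp (v : Fin M → X → Bool) (i : Fin t → Fin M) (z : Example X) :
    avgNe (v ∘ i) z.1 z.2 = hits {r | z ∈ errSet (v r)} ((List.finRange t).map i) / t := by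
  classical
  rw [avgNe, hits, List.countP_map, Function.comp_def (fun r => decide _),
    ← List.Nodup.card_eq_countP (List.nodup_finRange t)]
  congr! 3
  ext j
  simp [errSet]

/-- The law of `t` independent uniform draws, with replacement, from `M` items. -/
noncomputable def uniformDraws (M t : ℕ) [NeZero M] : Measure (Fin t → Fin M) :=
  Measure.pi fun _ => (PMF.uniformOfFintype (Fin M)).toMeasure

variable [NeZero M]

instance isProbabilityMeasure_uniformDraws : IsProbabilityMeasure (uniformDraws M t) := by
  unfold uniformDraws
  infer_instance

theorem measureReal_uniform_mem_errSet (v : Fin M → X → Bool) (z : Example X) :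
    (PMF.uniformOfFintype (Fin M)).toMeasure.real {r | z ∈ errSet (v r)} = avgNe v z.1 z.2 := by
  classical
  rw [measureReal_def, PMF.toMeasure_uniformOfFintype_apply _ (toFinite _).measurableSet,
    Fintype.card_subtype, Fintype.card_fin, ENNReal.toReal_div, ENNReal.toReal_natCast,
    ENNReal.toReal_natCast, avgNe]
  congr!

theorem exp_twentieth_le : Real.exp (1 / 20) ≤ 1 + 21 / 20 * (1 / 20) := by
  have h := exp_le_one_add_add_sq (x := 1 / 20) (by norm_num [abs_of_pos])
  norm_num at h ⊢
  linarith

theorem holdsExcept_notMem_errRegion_comp (v : Fin M → X → Bool) {z : Example X}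
    (hz : z ∉ errRegion v (10 / 243)) :
    HoldsExcept (uniformDraws M t) (Real.exp (-(t / 9720))) fun i =>
      z ∉ errRegion (v ∘ i) (11 / 243) := by
  have hp : avgNe v z.1 z.2 < 10 / 243 := not_le.1 hz
  refine (holdsExcept_hits_le _ (E := {r | z ∈ errSet (v r)}) (toFinite _).measurableSet
    (List.nodup_finRange t) exp_twentieth_le (Real.exp_pos _)).mono fun i hi => ?_
  rw [← Real.exp_neg, neg_neg, Real.log_exp, List.length_finRange,
    measureReal_uniform_mem_errSet] at hi
  rw [errRegion, mem_ofPred_eq, avgNe_comp, not_le]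
  rcases t.eq_zero_or_pos with rfl | ht
  · norm_num
  have ht' : (0 : ℝ) < t := by exact_mod_cast ht
  rw [div_lt_iff₀ ht']
  linarith [mul_lt_mul_of_pos_left hp ht']

variable [MeasurableSpace X]

theorem holdsExcept_measureReal_errRegion_comp_le (D : Measure (Example X))
    [IsProbabilityMeasure D] {v : Fin M → X → Bool} (hv : ∀ r, Measurable (v r)) {δ : ℝ}
    (hδ : 0 < δ) :
    HoldsExcept (uniformDraws M t) δ fun i =>
      D.real (errRegion (v ∘ i) (11 / 243))
        ≤ D.real (errRegion v (10 / 243)) + Real.exp (-(t / 9720)) / δ := by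
  set S : (Fin t → Fin M) → Set (Example X) := fun i =>
    errRegion (v ∘ i) (11 / 243) \ errRegion v (10 / 243)
  have hS : MeasurableSet {q : (Fin t → Fin M) × Example X | q.2 ∈ S q.1} := by
    refine (measurableSet_mem_errRegion (v := fun i => v ∘ i) (fun j => ?_) _).diff
      (measurable_snd (measurableSet_errRegion hv _))
    exact measurable_from_prod_countable_right fun i => hv (i j)
  have tail (z : Example X) : uniformDraws M t {i | z ∈ S i}
      ≤ ENNReal.ofReal (Real.exp (-(t / 9720))) := by
    by_cases hz : z ∈ errRegion v (10 / 243)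
    · simp [S, hz]
    rw [ENNReal.le_ofReal_iff_toReal_le (measure_ne_top _ _) (Real.exp_pos _).le]
    simpa [S, hz, HoldsExcept, measureReal_def] using
      holdsExcept_notMem_errRegion_comp (t := t) v hz
  have mass : ∫⁻ i, D (S i) ∂uniformDraws M t
      ≤ ENNReal.ofReal (δ * (Real.exp (-(t / 9720)) / δ)) := by
    calc
      _ = ∫⁻ z, uniformDraws M t {i | z ∈ S i} ∂D :=
        (Measure.prod_apply hS).symm.trans (Measure.prod_apply_symm hS)
      _ ≤ ∫⁻ _, ENNReal.ofReal (Real.exp (-(t / 9720))) ∂D := lintegral_mono tail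
      _ = _ := by rw [lintegral_const, measure_univ, mul_one, mul_div_cancel₀ _ hδ.ne']
  refine (HoldsExcept.of_lintegral_le (measurable_of_countable _).aemeasurable (by positivity)
    mass hδ.le).mono fun i hi => ?_
  have hSi : D.real (S i) ≤ Real.exp (-(t / 9720)) / δ :=
    ENNReal.toReal_le_of_le_ofReal (by positivity) hi.le
  linarith [le_measureReal_sdiff (μ := D) (s₁ := errRegion (v ∘ i) (11 / 243))
    (s₂ := errRegion v (10 / 243))]

theorem holdsExcept_prod_measureReal_errRegion_comp_le {Ω : Type*} [MeasurableSpace Ω]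
    (μ : Measure Ω) [IsProbabilityMeasure μ] (D : Measure (Example X)) [IsProbabilityMeasure D]
    {v : Ω → Fin M → X → Bool} (hv : ∀ r, Measurable fun p : Ω × X => v p.1 r p.2) {δ : ℝ}
    (hδ : 0 < δ) :
    HoldsExcept (μ.prod (uniformDraws M t)) δ fun p =>
      D.real (errRegion (v p.1 ∘ p.2) (11 / 243))
        ≤ D.real (errRegion (v p.1) (10 / 243)) + Real.exp (-(t / 9720)) / δ := by
  refine HoldsExcept.prod_left (p := fun ω i => D.real (errRegion (v ω ∘ i) (11 / 243))
    ≤ D.real (errRegion (v ω) (10 / 243)) + Real.exp (-(t / 9720)) / δ) ?_ fun ω =>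
    holdsExcept_measureReal_errRegion_comp_le D (fun r => (hv r).comp measurable_prodMk_left) hδ
  have base : Measurable fun ω => D.real (errRegion (v ω) (10 / 243)) :=
    measurable_measureReal_fiber D (measurableSet_mem_errRegion hv _)
  refine measurableSet_le ?_ ((base.comp measurable_fst).add_const _)
  exact measurable_from_prod_countable_left fun i => measurable_measureReal_fiber D
    (measurableSet_mem_errRegion (v := fun ω => v ω ∘ i) (fun j => hv (i j)) _)

end Sampling

section TieBreaking

variable {X : Type*} {t₁ t₂ : ℕ}

theorem avgNe_add_avgEq {t : ℕ} (ht : 0 < t) (v : Fin t → X → Bool) (x : X) (y : Bool) :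
    avgNe v x y + avgEq v x y = 1 := by
  have h := Finset.card_filter_add_card_filter_not (s := (Finset.univ : Finset (Fin t)))
    (fun j => v j x = y)
  rw [Finset.card_univ, Fintype.card_fin] at h
  rw [avgNe, avgEq, ← add_div, div_eq_one_iff_eq (by positivity), add_comm]
  exact_mod_cast h

theorem avgEq_not {t : ℕ} (v : Fin t → X → Bool) (x : X) (y : Bool) :
    avgEq v x (!y) = avgNe v x y := by
  simp [avgEq, avgNe, Bool.eq_not]

/-- The examples from which the tie-breaker is trained: those on which at least one of the two
families of voters has an error fraction of at least `11 / 243`. -/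
def tieRegion (v₁ : Fin t₁ → X → Bool) (v₂ : Fin t₂ → X → Bool) : Set (Example X) :=
  errRegion v₁ (11 / 243) ∪ errRegion v₂ (11 / 243)

open Classical in
theorem tieSample_eq_filter (v₁ : Fin t₁ → X → Bool) (v₂ : Fin t₂ → X → Bool)
    (S : List (Example X)) : tieSample v₁ v₂ S = S.filter (· ∈ tieRegion v₁ v₂) := by
  simp only [tieSample, tieRegion, errRegion, mem_union, mem_ofPred_eq]

theorem errSet_tie_subset (ht₁ : 0 < t₁) (ht₂ : 0 < t₂) (v₁ : Fin t₁ → X → Bool)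
    (v₂ : Fin t₂ → X → Bool) (h : X → Bool) :
    errSet (tie v₁ v₂ h) ⊆ (tieRegion v₁ v₂ ∩ errSet h)
      ∪ (errRegion v₁ (232 / 243) ∩ errRegion v₂ (232 / 243)) := by
  rintro ⟨x, y⟩ (hz : tie v₁ v₂ h x ≠ y)
  unfold tie at hz
  by_cases hnot : BothAgree v₁ v₂ x (!y)
  · right
    rwa [BothAgree, avgEq_not, avgEq_not] at hnot
  by_cases hy : BothAgree v₁ v₂ x y
  · cases y <;> simp_all
  refine .inl ⟨?_, by cases y <;> simp_all [errSet]⟩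
  by_contra! hz'
  obtain ⟨h₁ : ¬ 11 / 243 ≤ avgNe v₁ x y, h₂ : ¬ 11 / 243 ≤ avgNe v₂ x y⟩ := not_or.1 hz'
  exact hy ⟨by linarith [avgNe_add_avgEq ht₁ v₁ x y], by linarith [avgNe_add_avgEq ht₂ v₂ x y]⟩

variable [MeasurableSpace X]

theorem err_tie_le (D : Measure (Example X)) [IsFiniteMeasure D] (ht₁ : 0 < t₁) (ht₂ : 0 < t₂)
    {v₁ : Fin t₁ → X → Bool} {v₂ : Fin t₂ → X → Bool} (hv₁ : ∀ r, Measurable (v₁ r))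
    (hv₂ : ∀ r, Measurable (v₂ r)) (h : X → Bool) :
    err D (tie v₁ v₂ h) ≤ D.real (tieRegion v₁ v₂ ∩ errSet h)
      + 243 / 232 * avgErrOn D v₁ (errRegion v₂ (232 / 243)) := by
  have both := mul_measureReal_le_sum_avgErrOn D {()} (v := fun _ => v₁)
    (fun _ r => measurableSet_errSet (hv₁ r)) (measurableSet_errRegion hv₂ (232 / 243)) (232 / 243)
  simp only [Finset.sum_singleton] at both
  have cover : err D (tie v₁ v₂ h) ≤ _ :=
    (measureReal_mono (errSet_tie_subset ht₁ ht₂ v₁ v₂ h)).trans (measureReal_union_le _ _)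
  simp only [errRegion] at *
  linarith

end TieBreaking

section TieBreaker

variable {X ι : Type*}

open Classical in
theorem measurableSet_filter_eq {Ω : Type*} [MeasurableSpace Ω] {p : Ω → ι → Prop}
    (hp : ∀ i, MeasurableSet {ω | p ω i}) (L l : List ι) :
    MeasurableSet {ω | L.filter (p ω ·) = l} := by
  induction L generalizing l with
  | nil => simp
  | cons a L ih =>
    have hsplit : {ω | (a :: L).filter (p ω ·) = l}
        = ({ω | p ω a} ∩ {ω | a :: L.filter (p ω ·) = l})
          ∪ ({ω | p ω a}ᶜ ∩ {ω | L.filter (p ω ·) = l}) := by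
      ext ω
      by_cases h : p ω a <;> simp [h]
    rw [hsplit]
    refine ((hp a).inter ?_).union ((hp a).compl.inter (ih l))
    cases l with
    | nil => simp
    | cons b l =>
      simp only [List.cons.injEq]
      exact (MeasurableSet.const _).inter (ih l)

variable [MeasurableSpace X]

open Classical in
theorem measurable_learner_filter [Countable ι] {A : Learner X} (hAm : MeasurableLearner A)
    (L : List ι) {R : (ι → Example X) → Set (Example X)}
    (hR : MeasurableSet {q : (ι → Example X) × Example X | q.2 ∈ R q.1}) :
    Measurable fun p : (ι → Example X) × X => A ((L.map p.1).filter (· ∈ R p.1)) p.2 := by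
  refine measurable_to_bool ?_
  have hpre : (fun p : (ι → Example X) × X => A ((L.map p.1).filter (· ∈ R p.1)) p.2) ⁻¹' {true}
      = ⋃ l : List ι, {p | L.filter (p.1 · ∈ R p.1) = l} ∩ {p | A (l.map p.1) p.2 = true} := by
    ext p
    simp [List.filter_map, Function.comp_def]
  rw [hpre]
  refine .iUnion fun l => (measurableSet_filter_eq (fun i => ?_) L l).inter
    (measurable_learner_map hAm l (measurableSet_singleton true))
  have heval : Measurable fun p : (ι → Example X) × X => (p.1, p.1 i) := by fun_prop
  exact heval hR

variable [Fintype ι] {H : Set (X → Bool)} {d : ℕ} {A : Learner X} {h₀ : X → Bool}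

open Classical in
theorem holdsExcept_learner_filter_le (hd : VCDimLE H d) (hA : IsERM H A)
    (hAm : MeasurableLearner A) (D : Measure (Example X)) [IsProbabilityMeasure D] (hh₀ : h₀ ∈ H)
    {S : List ι} (hS : S.Nodup) {R : (ι → Example X) → Set (Example X)}
    (hR : MeasurableSet {q : (ι → Example X) × Example X | q.2 ∈ R q.1})
    (hRS : ∀ ω ω', (∀ i ∉ S, ω i = ω' i) → R ω = R ω') {δ : ℝ} (hδ : 0 < δ) :
    HoldsExcept (Measure.pi fun _ : ι => D) δ fun ω =>
      S.length * D.real (R ω ∩ errSet (A ((S.map ω).filter (· ∈ R ω))))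
        ≤ 1.0001 * hits (errSet h₀) (S.map ω) + S.length * D.real (R ω) / 10 ^ 18
          + 30000 * (54 * d + Real.log δ⁻¹) := by
  have h := holdsExcept_avgErrOn_le hd D one_pos
    (v := fun ω _ => A ((S.map ω).filter (· ∈ R ω))) (fun _ => measurable_learner_filter hAm S hR)
    (fun _ _ => (hA _).1) (I := fun _ => S) (fun _ => hS) (fun _ => rfl) hR (fun _ => hRS)
    (N := fun ω => hits (errSet h₀) (S.map ω)) (fun ω _ => ?_) hδ
  · simpa [avgErrOn] using h
  · rw [← hits_filter]
    exact (hA.hits_errSet_le _ hh₀).trans (hits_le_of_sublist _ List.filter_sublist)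

end TieBreaker

section Voters

variable {X ι : Type*}

theorem voters_eq_leaves_comp (A : Learner X) (k : ℕ) (S : List (Example X)) {t : ℕ}
    (i : Fin t → Fin (27 ^ (k / 6))) : voters A k S i = leaves A k S [] ∘ i := rfl

/-- The largest number of entries in `E` among the `27` blocks of `S`, which has length
`3 ^ (k + 6)`. -/
noncomputable def maxBlockHits {Z : Type*} (E : Set Z) (k : ℕ) (S : List Z) : ℕ :=
  Finset.univ.sup fun i : Fin 27 => hits E (block S i (3 ^ (k + 3)))

variable [MeasurableSpace X]

theorem measurable_voters_map {A : Learner X} (hAm : MeasurableLearner A) (k : ℕ) (S : List ι)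
    {t : ℕ} (i : Fin t → Fin (27 ^ (k / 6))) (j : Fin t) :
    Measurable fun p : (ι → Example X) × X => voters A k (S.map p.1) i j p.2 :=
  measurable_leaves_map hAm k S [] (i j)

theorem measurableSet_mem_errRegion_voters {A : Learner X} (hAm : MeasurableLearner A) (k : ℕ)
    (S : List ι) {t : ℕ} (i : Fin t → Fin (27 ^ (k / 6))) (θ : ℝ) :
    MeasurableSet {q : (ι → Example X) × Example X |
      q.2 ∈ errRegion (voters A k (S.map q.1) i) θ} :=
  measurableSet_mem_errRegion (v := fun ω => voters A k (S.map ω) i)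
    (measurable_voters_map hAm k S i) θ

variable [Fintype ι] {H : Set (X → Bool)} {d : ℕ} {A : Learner X} {h₀ : X → Bool}

theorem holdsExcept_avgErrOn_voters_le (hd : VCDimLE H d) (hA : IsERM H A)
    (hAm : MeasurableLearner A) (D : Measure (Example X)) [IsProbabilityMeasure D] (hh₀ : h₀ ∈ H)
    {k : ℕ} {S : List ι} (hS : S.length = 3 ^ (k + 6)) (hSn : S.Nodup) {t : ℕ} (ht : 0 < t)
    (i : Fin t → Fin (27 ^ ((k + 6) / 6))) {R : (ι → Example X) → Set (Example X)}
    (hR : MeasurableSet {q : (ι → Example X) × Example X | q.2 ∈ R q.1})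
    (hRS : ∀ ω ω', (∀ a ∉ S, ω a = ω' a) → R ω = R ω') {δ : ℝ} (hδ : 0 < δ) :
    HoldsExcept (Measure.pi fun _ : ι => D) δ fun ω =>
      26 * 3 ^ k * avgErrOn D (voters A (k + 6) (S.map ω) i) (R ω)
        ≤ 1.0001 * maxBlockHits (errSet h₀) k (S.map ω) + 26 * 3 ^ k * D.real (R ω) / 10 ^ 18
          + 30000 * (54 * d + Real.log δ⁻¹) := by
  choose b tail_sublist sublist_block using fun r =>
    exists_block_of_mem_splitting (leaf_mem (k + 6) S [] r)
  have h := holdsExcept_avgErrOn_learner_le hd hA hAm D hh₀ ht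
    (I := fun j => blockTail k S (b (i j))) (L := fun j => leaf (k + 6) S [] (i j))
    (fun j => hSn.sublist (blockTail_sublist k S _)) (fun j => length_blockTail hS _)
    (fun j => tail_sublist (i j)) hR
    (fun j ω ω' hω => hRS ω ω' fun a ha => hω a fun ha' =>
      ha ((blockTail_sublist k S _).subset ha'))
    (N := fun ω => maxBlockHits (errSet h₀) k (S.map ω)) (fun ω j => ?_) hδ
  · have voters_map (ω : ι → Example X) :
        voters A (k + 6) (S.map ω) i = fun j => A ((leaf (k + 6) S [] (i j)).map ω) :=
      funext fun j => congrFun (leaves_map A (k + 6) S [] ω) (i j)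
    simpa only [voters_map, Nat.cast_mul, Nat.cast_pow, Nat.cast_ofNat] using h
  · refine (hits_le_of_sublist _ ((sublist_block (i j)).map ω)).trans ?_
    rw [← block_map]
    exact Finset.le_sup (f := fun b : Fin 27 => hits (errSet h₀) (block (S.map ω) b (3 ^ (k + 3))))
      (Finset.mem_univ _)

end Voters

section HitsBounds

variable {ι : Type*} [Fintype ι] {Z : Type*} [MeasurableSpace Z] (D : Measure Z)
  [IsProbabilityMeasure D] {E : Set Z} {δ : ℝ}

theorem holdsExcept_hits_le_add (hE : MeasurableSet E) {I : List ι} (hI : I.Nodup) (hδ : 0 < δ) :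
    HoldsExcept (Measure.pi fun _ : ι => D) δ fun ω =>
      hits E (I.map ω) ≤ 1.0001 * (I.length * D.real E) + 30000 * Real.log δ⁻¹ := by
  refine (holdsExcept_hits_le D hE hI (l := 1 / 30000) (κ := 1.0001) ?_ hδ).mono
    fun ω hω => by linarith
  refine (exp_le_one_add_add_sq (by norm_num)).trans ?_
  norm_num

theorem holdsExcept_maxBlockHits_le (hE : MeasurableSet E) {k : ℕ} {S : List ι}
    (hS : S.length = 3 ^ (k + 6)) (hSn : S.Nodup) (hδ : 0 < δ) :
    HoldsExcept (Measure.pi fun _ : ι => D) (27 * δ) fun ω =>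
      maxBlockHits E k (S.map ω) ≤ 1.0001 * (27 * 3 ^ k * D.real E) + 30000 * Real.log δ⁻¹ := by
  have blocks := HoldsExcept.forall_of_fintype fun b : Fin 27 =>
    holdsExcept_hits_le_add D hE ((block_sublist S b (3 ^ (k + 3))).nodup hSn) hδ
  rw [Fintype.card_fin, Nat.cast_ofNat] at blocks
  refine blocks.mono fun ω hω => ?_
  obtain ⟨b, -, hb⟩ := Finset.exists_mem_eq_sup Finset.univ Finset.univ_nonempty
    fun b : Fin 27 => hits E (block (S.map ω) b (3 ^ (k + 3)))
  rw [maxBlockHits, hb, block_map]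
  have hωb := hω b
  have block_size : ((3 ^ (k + 3) : ℕ) : ℝ) = 27 * 3 ^ k := by push_cast; ring
  rwa [length_block_three_pow hS, block_size] at hωb

end HitsBounds

section TieMass

variable {X ι : Type*} [MeasurableSpace X] [Fintype ι] {H : Set (X → Bool)} {d : ℕ}
  {A : Learner X} {h₀ : X → Bool} {k t t₁ t₂ : ℕ} {S L₁ L₂ : List ι} {δ : ℝ}

instance isProbabilityMeasure_draws (k t : ℕ) : IsProbabilityMeasure (draws k t) :=
  inferInstanceAs (IsProbabilityMeasure (uniformDraws (27 ^ (k / 6)) t))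

theorem holdsExcept_measureReal_errRegion_voters_le (hd : VCDimLE H d) (hA : IsERM H A)
    (hAm : MeasurableLearner A) (D : Measure (Example X)) [IsProbabilityMeasure D] (hh₀ : h₀ ∈ H)
    (hm : Measurable h₀) (hS : S.length = 3 ^ k) (hSn : S.Nodup) (hδ : 0 < δ) (hδ1 : δ ≤ 1) :
    HoldsExcept ((Measure.pi fun _ : ι => D).prod (draws k t)) (3 * δ) fun p =>
      3 ^ k * D.real (errRegion (voters A k (S.map p.1) p.2) (11 / 243))
        ≤ 2 * 10 ^ 12 * (3 ^ k * err D h₀) + 10 ^ 17 * (d + (1 + Real.log δ⁻¹))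
          + 3 ^ k * (Real.exp (-(t / 9720)) / δ) := by
  have sampling := holdsExcept_prod_measureReal_errRegion_comp_le (t := t)
    (Measure.pi fun _ : ι => D) D (v := fun ω => leaves A k (S.map ω) [])
    (measurable_leaves_map hAm k S []) hδ
  have region := HoldsExcept.comp (measurePreserving_fst (ν := draws k t))
    (holdsExcept_measureReal_errRegion_leaves_le hd hA hAm D hh₀ hS (T := [])
      (by rwa [List.append_nil]) hδ hδ1)
  have errors := HoldsExcept.comp (measurePreserving_fst (ν := draws k t))
    (holdsExcept_hits_le_add D (measurableSet_errSet hm) hSn hδ)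
  refine ((sampling.and (region.and errors)).mono_prob (by linarith)).mono
    fun p ⟨hsampling, hregion, herrors⟩ => ?_
  rw [List.append_nil] at hregion
  rw [hS] at herrors
  push_cast at herrors
  have hL : 0 ≤ Real.log δ⁻¹ := Real.log_nonneg ((one_le_inv₀ hδ).2 hδ1)
  have herr : 0 ≤ 3 ^ k * err D h₀ := mul_nonneg (by positivity) measureReal_nonneg
  have hsampling' := mul_le_mul_of_nonneg_left hsampling (show (0 : ℝ) ≤ 3 ^ k by positivity)
  rw [mul_add] at hsampling'
  rw [voters_eq_leaves_comp]
  change (_ : ℝ) ≤ 1.0001 * (3 ^ k * err D h₀) + _ at herrors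
  simp only [List.map_nil] at hregion
  linarith [d.cast_nonneg (α := ℝ)]

theorem holdsExcept_measureReal_tieRegion_le (hd : VCDimLE H d) (hA : IsERM H A)
    (hAm : MeasurableLearner A) (D : Measure (Example X)) [IsProbabilityMeasure D] (hh₀ : h₀ ∈ H)
    (hm : Measurable h₀) (hL₁ : L₁.length = 3 ^ k) (hL₂ : L₂.length = 3 ^ k) (hn₁ : L₁.Nodup)
    (hn₂ : L₂.Nodup) (hδ : 0 < δ) (hδ1 : δ ≤ 1)
    (ht₁ : 3 ^ k * (Real.exp (-(t₁ / 9720)) / δ) ≤ 6 * (d + (1 + Real.log δ⁻¹)))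
    (ht₂ : 3 ^ k * (Real.exp (-(t₂ / 9720)) / δ) ≤ 6 * (d + (1 + Real.log δ⁻¹))) :
    HoldsExcept ((Measure.pi fun _ : ι => D).prod ((draws k t₁).prod (draws k t₂))) (6 * δ)
      fun p => 3 ^ k * D.real (tieRegion (voters A k (L₁.map p.1) p.2.1)
          (voters A k (L₂.map p.1) p.2.2))
        ≤ 4 * 10 ^ 12 * (3 ^ k * err D h₀) + 10 ^ 18 * (d + (1 + Real.log δ⁻¹)) := by
  have region₁ := HoldsExcept.comp
    ((MeasurePreserving.id _).prod (measurePreserving_fst (ν := draws k t₂)))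
    (holdsExcept_measureReal_errRegion_voters_le (t := t₁) hd hA hAm D hh₀ hm hL₁ hn₁ hδ hδ1)
  have region₂ := HoldsExcept.comp
    ((MeasurePreserving.id _).prod (measurePreserving_snd (μ := draws k t₁)))
    (holdsExcept_measureReal_errRegion_voters_le (t := t₂) hd hA hAm D hh₀ hm hL₂ hn₂ hδ hδ1)
  refine ((region₁.and region₂).mono_prob (by linarith)).mono fun p ⟨h₁, h₂⟩ => ?_
  simp only [Prod.map_apply', id_eq] at h₁ h₂
  have hL : 0 ≤ Real.log δ⁻¹ := Real.log_nonneg ((one_le_inv₀ hδ).2 hδ1)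
  calc
    _ ≤ 3 ^ k * (D.real (errRegion (voters A k (L₁.map p.1) p.2.1) (11 / 243))
          + D.real (errRegion (voters A k (L₂.map p.1) p.2.2) (11 / 243))) := by
      gcongr
      exact measureReal_union_le _ _
    _ ≤ _ := by linarith [d.cast_nonneg (α := ℝ)]

end TieMass

section MainEstimate

variable {X ι : Type*} [MeasurableSpace X] [Fintype ι] {H : Set (X → Bool)} {d : ℕ}
  {A : Learner X} {h₀ : X → Bool} {k t₁ t₂ : ℕ} {L₁ L₂ L₃ : List ι} {δ : ℝ}

theorem holdsExcept_tieBreaker_le (hd : VCDimLE H d) (hA : IsERM H A)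
    (hAm : MeasurableLearner A) (D : Measure (Example X)) [IsProbabilityMeasure D] (hh₀ : h₀ ∈ H)
    (hm : Measurable h₀) (hL₃ : L₃.length = 3 ^ k) (hn₃ : L₃.Nodup) (h₁₃ : L₁.Disjoint L₃)
    (h₂₃ : L₂.Disjoint L₃) (i₁ : Fin t₁ → Fin (27 ^ (k / 6))) (i₂ : Fin t₂ → Fin (27 ^ (k / 6)))
    (hδ : 0 < δ) (hδ1 : δ ≤ 1) :
    HoldsExcept (Measure.pi fun _ : ι => D) (2 * δ) fun ω =>
      let v₁ := voters A k (L₁.map ω) i₁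
      let v₂ := voters A k (L₂.map ω) i₂
      3 ^ k * D.real (tieRegion v₁ v₂ ∩ errSet (A (tieSample v₁ v₂ (L₃.map ω))))
        ≤ 1.0003 * (3 ^ k * err D h₀) + 3 ^ k * D.real (tieRegion v₁ v₂) / 10 ^ 18
          + 2 * 10 ^ 6 * (d + (1 + Real.log δ⁻¹)) := by
  have training := holdsExcept_learner_filter_le hd hA hAm D hh₀ hn₃
    (R := fun ω => tieRegion (voters A k (L₁.map ω) i₁) (voters A k (L₂.map ω) i₂))
    ((measurableSet_mem_errRegion_voters hAm k L₁ i₁ _).union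
      (measurableSet_mem_errRegion_voters hAm k L₂ i₂ _))
    (fun ω ω' hω => by
      rw [List.map_congr_left fun a ha => hω a (h₁₃ ha),
        List.map_congr_left fun a ha => hω a (h₂₃ ha)]) hδ
  have errors := holdsExcept_hits_le_add D (measurableSet_errSet hm) hn₃ hδ
  refine ((training.and errors).mono_prob (by linarith)).mono fun ω ⟨htraining, herrors⟩ => ?_
  have size : (L₃.length : ℝ) = 3 ^ k := by rw [hL₃, Nat.cast_pow, Nat.cast_ofNat]
  rw [size] at htraining herrors
  change (_ : ℝ) ≤ 1.0001 * (3 ^ k * err D h₀) + _ at herrors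
  have hL : 0 ≤ Real.log δ⁻¹ := Real.log_nonneg ((one_le_inv₀ hδ).2 hδ1)
  have herr : 0 ≤ 3 ^ k * err D h₀ := mul_nonneg (by positivity) measureReal_nonneg
  simp only [tieSample_eq_filter]
  linarith [d.cast_nonneg (α := ℝ)]

theorem holdsExcept_voters_le (hd : VCDimLE H d) (hA : IsERM H A) (hAm : MeasurableLearner A)
    (D : Measure (Example X)) [IsProbabilityMeasure D] (hh₀ : h₀ ∈ H) (hm : Measurable h₀)
    (hL₁ : L₁.length = 3 ^ (k + 6)) (hn₁ : L₁.Nodup) (h₁₂ : L₁.Disjoint L₂) (ht₁ : 0 < t₁)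
    (i₁ : Fin t₁ → Fin (27 ^ ((k + 6) / 6))) (i₂ : Fin t₂ → Fin (27 ^ ((k + 6) / 6)))
    (hδ : 0 < δ) (hδ1 : δ ≤ 1) :
    HoldsExcept (Measure.pi fun _ : ι => D) (28 * δ) fun ω =>
      let R := errRegion (voters A (k + 6) (L₂.map ω) i₂) (232 / 243)
      3 ^ (k + 6) * avgErrOn D (voters A (k + 6) (L₁.map ω) i₁) R
        ≤ 1.0003 * (27 / 26) * (3 ^ (k + 6) * err D h₀) + 3 ^ (k + 6) * D.real R / 10 ^ 18
          + 5 * 10 ^ 7 * (d + (1 + Real.log δ⁻¹)) := by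
  have training := holdsExcept_avgErrOn_voters_le hd hA hAm D hh₀ hL₁ hn₁ ht₁ i₁
    (R := fun ω => errRegion (voters A (k + 6) (L₂.map ω) i₂) (232 / 243))
    (measurableSet_mem_errRegion_voters hAm (k + 6) L₂ i₂ (232 / 243))
    (fun ω ω' hω => by rw [List.map_congr_left fun a ha => hω a fun h => h₁₂ h ha]) hδ
  have errors := holdsExcept_maxBlockHits_le D (measurableSet_errSet hm) hL₁ hn₁ hδ
  refine ((training.and errors).mono_prob (by linarith)).mono fun ω ⟨htraining, herrors⟩ => ?_
  change (_ : ℝ) ≤ 1.0001 * (27 * 3 ^ k * err D h₀) + _ at herrors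
  have hL : 0 ≤ Real.log δ⁻¹ := Real.log_nonneg ((one_le_inv₀ hδ).2 hδ1)
  have herr : 0 ≤ 3 ^ k * err D h₀ := mul_nonneg (by positivity) measureReal_nonneg
  simp only [pow_add]
  linarith [d.cast_nonneg (α := ℝ)]

theorem holdsExcept_err_tie_le (hd : VCDimLE H d) (hA : IsERM H A) (hAm : MeasurableLearner A)
    (D : Measure (Example X)) [IsProbabilityMeasure D] (hh₀ : h₀ ∈ H) (hm : Measurable h₀)
    (hL₁ : L₁.length = 3 ^ (k + 6)) (hL₂ : L₂.length = 3 ^ (k + 6))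
    (hL₃ : L₃.length = 3 ^ (k + 6)) (hn₁ : L₁.Nodup) (hn₂ : L₂.Nodup) (hn₃ : L₃.Nodup)
    (h₁₂ : L₁.Disjoint L₂) (h₁₃ : L₁.Disjoint L₃) (h₂₃ : L₂.Disjoint L₃)
    (ht₁ : 0 < t₁) (ht₂ : 0 < t₂) (hδ : 0 < δ) (hδ1 : δ ≤ 1)
    (hδt₁ : 3 ^ (k + 6) * (Real.exp (-(t₁ / 9720)) / δ) ≤ 6 * (d + (1 + Real.log δ⁻¹)))
    (hδt₂ : 3 ^ (k + 6) * (Real.exp (-(t₂ / 9720)) / δ) ≤ 6 * (d + (1 + Real.log δ⁻¹))) :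
    HoldsExcept
      ((Measure.pi fun _ : ι => D).prod ((draws (k + 6) t₁).prod (draws (k + 6) t₂))) (36 * δ)
      fun p =>
        let v₁ := voters A (k + 6) (L₁.map p.1) p.2.1
        let v₂ := voters A (k + 6) (L₂.map p.1) p.2.2
        3 ^ (k + 6) * err D (tie v₁ v₂ (A (tieSample v₁ v₂ (L₃.map p.1))))
          ≤ 2.0888 * (3 ^ (k + 6) * err D h₀) + 6 * 10 ^ 7 * (d + (1 + Real.log δ⁻¹)) := by
  have mass := holdsExcept_measureReal_tieRegion_le hd hA hAm D hh₀ hm hL₁ hL₂ hn₁ hn₂ hδ hδ1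
    hδt₁ hδt₂
  have tieBreaker := HoldsExcept.prod (ν := (draws (k + 6) t₁).prod (draws (k + 6) t₂)) fun i =>
    holdsExcept_tieBreaker_le hd hA hAm D hh₀ hm hL₃ hn₃ h₁₃ h₂₃ i.1 i.2 hδ hδ1
  have voting := HoldsExcept.prod (ν := (draws (k + 6) t₁).prod (draws (k + 6) t₂)) fun i =>
    holdsExcept_voters_le hd hA hAm D hh₀ hm hL₁ hn₁ h₁₂ ht₁ i.1 i.2 hδ hδ1
  refine ((mass.and (tieBreaker.and voting)).mono_prob (by linarith)).mono
    fun ⟨ω, i₁, i₂⟩ ⟨hmass, htie, hvoting⟩ => ?_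
  dsimp only at hmass htie hvoting ⊢
  set v₁ := voters A (k + 6) (L₁.map ω) i₁
  set v₂ := voters A (k + 6) (L₂.map ω) i₂
  set h := A (tieSample v₁ v₂ (L₃.map ω))
  have cover : 3 ^ (k + 6) * err D (tie v₁ v₂ h) ≤ _ := mul_le_mul_of_nonneg_left
    (err_tie_le D ht₁ ht₂ (v₁ := v₁) (v₂ := v₂) (fun _ => hAm.measurable _)
      (fun _ => hAm.measurable _) h) (by positivity)
  have wrong : 3 ^ (k + 6) * D.real (errRegion v₂ (232 / 243))
      ≤ 3 ^ (k + 6) * D.real (tieRegion v₁ v₂) := by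
    gcongr
    · exact measure_ne_top _ _
    · exact fun z hz => .inr (errRegion_anti v₂ (by norm_num) hz)
  have hL : 0 ≤ Real.log δ⁻¹ := Real.log_nonneg ((one_le_inv₀ hδ).2 hδ1)
  have herr : 0 ≤ 3 ^ (k + 6) * err D h₀ := mul_nonneg (by positivity) measureReal_nonneg
  linarith [d.cast_nonneg (α := ℝ)]

theorem holdsExcept_err_tieMajority_le (hd : VCDimLE H d) (hA : IsERM H A)
    (hAm : MeasurableLearner A) (D : Measure (Example X)) [IsProbabilityMeasure D] (hh₀ : h₀ ∈ H)
    (hm : Measurable h₀) {I : List ι} (hI : I.length = 3 ^ (k + 7)) (hIn : I.Nodup)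
    (ht₁ : 0 < t₁) (ht₂ : 0 < t₂) (hδ : 0 < δ) (hδ1 : δ ≤ 1)
    (hδt₁ : 3 ^ (k + 6) * (Real.exp (-(t₁ / 9720)) / δ) ≤ 6 * (d + (1 + Real.log δ⁻¹)))
    (hδt₂ : 3 ^ (k + 6) * (Real.exp (-(t₂ / 9720)) / δ) ≤ 6 * (d + (1 + Real.log δ⁻¹))) :
    HoldsExcept
      ((Measure.pi fun _ : ι => D).prod ((draws (k + 6) t₁).prod (draws (k + 6) t₂))) (36 * δ)
      fun p => 3 ^ (k + 6) * err D (tieMajority A (k + 7) (I.map p.1) p.2.1 p.2.2)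
        ≤ 2.0888 * (3 ^ (k + 6) * err D h₀) + 6 * 10 ^ 7 * (d + (1 + Real.log δ⁻¹)) := by
  rw [pow_succ'] at hI
  have length {i : ℕ} (hi : i < 3) := length_block hI hi
  have nodup (i : ℕ) := (block_sublist I i (3 ^ (k + 6))).nodup hIn
  have disjoint {i j : ℕ} (hij : i ≠ j) := disjoint_block hIn hij (3 ^ (k + 6))
  have h := holdsExcept_err_tie_le hd hA hAm D hh₀ hm (length zero_lt_three)
    (length (by norm_num : 1 < 3)) (length (by norm_num : 2 < 3)) (nodup 0) (nodup 1) (nodup 2)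
    (disjoint zero_ne_one) (disjoint (by norm_num : 0 ≠ 2)) (disjoint (by norm_num : 1 ≠ 2))
    ht₁ ht₂ hδ hδ1 hδt₁ hδt₂
  simp only [tieMajority, block_map]
  exact h

end MainEstimate

section Constants

variable {δ : ℝ}

theorem log_eightySix_div_le (hδ : 0 < δ) :
    Real.log (86 / δ) ≤ 1 + Real.log (δ / 36)⁻¹ := by
  rw [← Real.log_exp 1, ← Real.log_mul (Real.exp_pos 1).ne' (by positivity)]
  gcongr
  rw [inv_div, ← mul_div_assoc]
  gcongr
  linarith [Real.exp_one_gt_d9]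

theorem exp_neg_le_inv_of_log_le {x : ℝ} (hx : 0 < x) {t : ℕ}
    (ht : 4 * 243 ^ 2 * Real.log x ≤ t) : Real.exp (-(t / 9720)) ≤ x⁻¹ := by
  rw [← Real.exp_log (inv_pos.2 hx), Real.exp_le_exp, Real.log_inv]
  linarith [t.cast_nonneg (α := ℝ)]

theorem log_exp_one_div (hδ : 0 < δ) : Real.log (Real.exp 1 / δ) = 1 + Real.log δ⁻¹ := by
  rw [div_eq_mul_inv, Real.log_mul (Real.exp_pos 1).ne' (by positivity), Real.log_exp]

theorem three_pow_mul_exp_le {k d t : ℕ} (hδ : 0 < δ) (hδ1 : δ ≤ 1)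
    (ht : 4 * 243 ^ 2 * Real.log (2 * 3 ^ (k + 1) / (δ * (d + Real.log (86 / δ)))) ≤ t) :
    3 ^ k * (Real.exp (-(t / 9720)) / (δ / 36)) ≤ 6 * (d + (1 + Real.log (δ / 36)⁻¹)) := by
  have hlog : 0 < Real.log (86 / δ) := Real.log_pos (by rw [lt_div_iff₀ hδ]; linarith)
  have hQ : 0 < d + Real.log (86 / δ) := by positivity
  calc
    _ ≤ 3 ^ k * ((2 * 3 ^ (k + 1) / (δ * (d + Real.log (86 / δ))))⁻¹ / (δ / 36)) := by
      gcongr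
      exact exp_neg_le_inv_of_log_le (by positivity) ht
    _ = 6 * (d + Real.log (86 / δ)) := by field_simp; ring
    _ ≤ _ := by gcongr; exact log_eightySix_div_le hδ

theorem log_two_mul_div_pos {d : ℕ} {m : ℝ} (hδ : 0 < δ) (hδ1 : δ ≤ 1)
    (hm : 10 ^ 10 * (d + (1 + Real.log δ⁻¹)) < m) :
    0 < Real.log (2 * m / (δ * (d + Real.log (86 / δ)))) := by
  have hlog : 0 < Real.log (86 / δ) := Real.log_pos (by rw [lt_div_iff₀ hδ]; linarith)
  have hQ : 0 < d + Real.log (86 / δ) := by positivity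
  refine Real.log_pos ((one_lt_div (by positivity)).2 ?_)
  calc
    δ * (d + Real.log (86 / δ)) ≤ 1 * (d + (1 + Real.log (δ / 36)⁻¹)) := by
      gcongr
      exact log_eightySix_div_le hδ
    _ < 2 * m := by
      have hL : 0 ≤ Real.log δ⁻¹ := Real.log_nonneg ((one_le_inv₀ hδ).2 hδ1)
      linarith [log_inv_div_le (c := 36) (by norm_num) (by norm_num) hδ,
        d.cast_nonneg (α := ℝ)]

end Constants

section BestError

variable {X : Type*} [MeasurableSpace X]

theorem bestErr_nonneg (D : Measure (Example X)) (H : Set (X → Bool)) : 0 ≤ bestErr D H :=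
  Real.sInf_nonneg (by rintro _ ⟨h, -, rfl⟩; exact measureReal_nonneg)

theorem exists_err_lt_bestErr_add (D : Measure (Example X)) {H : Set (X → Bool)}
    (hH : H.Nonempty) {η : ℝ} (hη : 0 < η) : ∃ h ∈ H, err D h < bestErr D H + η := by
  simpa [bestErr] using Real.lt_sInf_add_pos (hH.image (err D)) hη

end BestError

section ExcessError

variable {X ι : Type*} [MeasurableSpace X] [Fintype ι] {H : Set (X → Bool)} {d : ℕ}
  {A : Learner X} {k t₁ t₂ : ℕ} {δ : ℝ}

theorem holdsExcept_err_tieMajority_le_bestErr_add (hd : VCDimLE H d)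
    (hH : ∀ h ∈ H, Measurable h) (hA : IsERM H A) (hAm : MeasurableLearner A)
    (D : Measure (Example X)) [IsProbabilityMeasure D] {I : List ι}
    (hI : I.length = 3 ^ (k + 7)) (hIn : I.Nodup) (ht₁ : 0 < t₁) (ht₂ : 0 < t₂) (hδ : 0 < δ)
    (hδ1 : δ ≤ 1)
    (hδt₁ : 4 * 243 ^ 2 * Real.log (2 * 3 ^ (k + 7) / (δ * (d + Real.log (86 / δ)))) ≤ t₁)
    (hδt₂ : 4 * 243 ^ 2 * Real.log (2 * 3 ^ (k + 7) / (δ * (d + Real.log (86 / δ)))) ≤ t₂) :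
    HoldsExcept ((Measure.pi fun _ : ι => D).prod ((draws (k + 6) t₁).prod (draws (k + 6) t₂))) δ
      fun p => err D (tieMajority A (k + 7) (I.map p.1) p.2.1 p.2.2)
        ≤ 2.0888 * bestErr D H + 10 ^ 10 * (d + (1 + Real.log δ⁻¹)) / 3 ^ (k + 7) := by
  obtain ⟨h₀, hh₀, herr⟩ := exists_err_lt_bestErr_add D ⟨_, (hA []).1⟩
    (inv_pos.2 (show (0 : ℝ) < 3 ^ (k + 6) by positivity))
  have bound := holdsExcept_err_tieMajority_le hd hA hAm D hh₀ (hH h₀ hh₀) hI hIn ht₁ ht₂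
    (δ := δ / 36) (by positivity) (by linarith) (three_pow_mul_exp_le hδ hδ1 hδt₁)
    (three_pow_mul_exp_le hδ hδ1 hδt₂)
  have hL : 0 ≤ Real.log δ⁻¹ := Real.log_nonneg ((one_le_inv₀ hδ).2 hδ1)
  have hlog := log_inv_div_le (c := 36) (by norm_num) (by norm_num) hδ
  refine (bound.mono_prob (by linarith)).mono fun p hp => ?_
  have competitor : (3 : ℝ) ^ (k + 6) * err D h₀ ≤ 3 ^ (k + 6) * bestErr D H + 1 := by
    have := mul_le_mul_of_nonneg_left herr.le (show (0 : ℝ) ≤ 3 ^ (k + 6) by positivity)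
    rwa [mul_add, mul_inv_cancel₀ (by positivity)] at this
  refine le_of_mul_le_mul_left ?_ (show (0 : ℝ) < 3 ^ (k + 6) by positivity)
  have remainder : (3 : ℝ) ^ (k + 6) * (10 ^ 10 * (d + (1 + Real.log δ⁻¹)) / 3 ^ (k + 7))
      = 10 ^ 10 * (d + (1 + Real.log δ⁻¹)) / 3 := by
    rw [pow_succ' _ (k + 6)]
    field_simp
  rw [mul_add, remainder]
  linarith [d.cast_nonneg (α := ℝ)]

end ExcessError

end TieLearn

open TieLearn in
theorem mainTheorem2_general {X : Type*} [MeasurableSpace X] {H : Set (X → Bool)} {d : ℕ}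
    (hd : VCDimLE H d) (hH : ∀ h ∈ H, Measurable h) {A : Learner X} (hA : IsERM H A)
    (hAm : MeasurableLearner A) (D : Measure (Example X)) [IsProbabilityMeasure D] {δ : ℝ}
    (hδ : 0 < δ) (hδ1 : δ ≤ 1) {m k t₁ t₂ : ℕ} (hm : m = 3 ^ (k + 1))
    (ht₁ : 4 * 243 ^ 2 * Real.log (2 * m / (δ * (d + Real.log (86 / δ)))) ≤ t₁)
    (ht₂ : 4 * 243 ^ 2 * Real.log (2 * m / (δ * (d + Real.log (86 / δ)))) ≤ t₂) :
    1 - δ ≤ ((Measure.pi fun _ : Fin m => D).prod ((draws k t₁).prod (draws k t₂))).real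
      {ω | err D (tieMajority A (k + 1) (List.ofFn ω.1) ω.2.1 ω.2.2)
        ≤ 2.0888 * bestErr D H + 10 ^ 10 * (d + Real.log (Real.exp 1 / δ)) / m} := by
  refine HoldsExcept.one_sub_le (p := fun ω => _ ≤ _) ?_
  have hm0 : (0 : ℝ) < m := by rw [hm]; positivity
  rw [log_exp_one_div hδ]
  obtain small | large := le_or_gt (m : ℝ) (10 ^ 10 * (d + (1 + Real.log δ⁻¹)))
  · refine .of_forall hδ.le fun ω => ?_
    have err_le_one : err D (tieMajority A (k + 1) (List.ofFn ω.1) ω.2.1 ω.2.2) ≤ 1 :=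
      measureReal_le_one
    linarith [(one_le_div hm0).2 small, bestErr_nonneg D H]
  obtain ⟨k, rfl⟩ : ∃ j, k = j + 6 := by
    have hm_gt : 3 ^ 6 < m := by
      have : (3 ^ 6 : ℝ) < m := by
        linarith [d.cast_nonneg (α := ℝ), Real.log_nonneg ((one_le_inv₀ hδ).2 hδ1)]
      exact_mod_cast this
    rw [hm, Nat.pow_lt_pow_iff_right (by norm_num)] at hm_gt
    exact ⟨k - 6, by lia⟩
  have hpos {t : ℕ} (ht : 4 * 243 ^ 2 * Real.log (2 * m / (δ * (d + Real.log (86 / δ)))) ≤ t) :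
      0 < t :=
    Nat.cast_pos.1 ((mul_pos (by norm_num) (log_two_mul_div_pos hδ hδ1 large)).trans_le ht)
  have ht₁_pos := hpos ht₁
  have ht₂_pos := hpos ht₂
  subst hm
  push_cast at ht₁ ht₂ ⊢
  simp only [List.ofFn_eq_map]
  exact holdsExcept_err_tieMajority_le_bestErr_add hd hH hA hAm D (List.length_finRange ..)
    (List.nodup_finRange _) ht₁_pos ht₂_pos hδ hδ1 ht₁ ht₂

theorem mainTheorem2 :
    ∃ c : ℝ, 1 ≤ c ∧
      ∀ (X : Type*) [MeasurableSpace X] (H : Set (X → Bool)) (d : ℕ)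
        (_hd : TieLearn.HasVCDim H d) (_hH : ∀ h ∈ H, Measurable h)
        (A : TieLearn.Learner X) (_hA : TieLearn.IsERM H A)
        (_hAm : TieLearn.MeasurableLearner A)
        (D : MeasureTheory.Measure (TieLearn.Example X)) [MeasureTheory.IsProbabilityMeasure D]
        (δ : ℝ) (_hδ0 : 0 < δ) (_hδ1 : δ < 1)
        (m k : ℕ) (_hm : m = 3 ^ k) (_hk : 5 ≤ k) (t₁ t₂ : ℕ)
        (_ht₁ : 4 * 243 ^ 2 * Real.log (2 * m / (δ * (d + Real.log (86 / δ)))) ≤ (t₁ : ℝ))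
        (_ht₂ : 4 * 243 ^ 2 * Real.log (2 * m / (δ * (d + Real.log (86 / δ)))) ≤ (t₂ : ℝ)),
        1 - δ ≤
          ((MeasureTheory.Measure.pi fun _ : Fin m => D).prod
            ((TieLearn.draws (k - 1) t₁).prod (TieLearn.draws (k - 1) t₂))).real
            {ω | TieLearn.err D (TieLearn.tieMajority A k (List.ofFn ω.1) ω.2.1 ω.2.2) ≤
              2.0888 * TieLearn.bestErr D H
                + √(c * TieLearn.bestErr D H * (d + Real.log (Real.exp 1 / δ)) / m)
                + c * (d + Real.log (Real.exp 1 / δ)) / m} := by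
  refine ⟨10 ^ 10, by norm_num, ?_⟩
  intro X _ H d hd hH A hA hAm D _ δ hδ0 hδ1 m k hm hk t₁ t₂ ht₁ ht₂
  obtain ⟨k, rfl⟩ : ∃ j, k = j + 1 := ⟨k - 1, by lia⟩
  exact (mainTheorem2_general hd.vcDimLE hH hA hAm D hδ0 hδ1.le hm ht₁ ht₂).trans
    (measureReal_mono fun ω hω => hω.trans
      (add_le_add_left (le_add_of_nonneg_right (Real.sqrt_nonneg _)) _))
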